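/- Consider quantum query algorithms for the modal frequency problem: for an array $A$ of $n\ge 1$ entries from $\{0,\dots,m-1\}$, $m\ge 1$, accessed through the oracle $|i\rangle|b\rangle\mapsto|i\rangle|b\oplus A[i]\rangle$, estimate $F_\infty(A)=\max_v |\{i : A[i]=v\}|$. The index and the value are held in binary in $\lceil\log_2 n\rceil$ and $\lceil\log_2 m\rceil$ qubits. An algorithm may apply arbitrary unitaries independent of $A$, queries, standard-basis measurements and resets of qubits. All of its memory, including the oracle's registers, counts as qubits, and the number of queries is a worst-case count. There are absolute constants $C>0$ and $k\in\mathbb{N}$ such that for all $n,m\ge 1$ and every error probability $\delta\in(0,1)$ the following hold. 1. (Additive accuracy.) For every $\varepsilon\in(0,n)$ there is a quantum algorithm that, on every array $A$, outputs with probability at least $1-\delta$ a real number $\widehat F$ with $|\widehat F-F_\infty(A)|\le\varepsilon$, and that uses at most $$C\left(\frac n\varepsilon\right)^{3/2}\log\frac n\varepsilon\cdot\Big(\log\frac{n}{\delta\varepsilon}\Big)^{k}$$ queries, i.e. $\tilde O\big((n/\varepsilon)^{3/2}\log(n/\varepsilon)\big)$ queries, and at most $$C\Big(\big(\log m+\log\tfrac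 n\varepsilon\big)\log\tfrac{n}{\delta\varepsilon}+\log n\Big)$$ qubits. (The last summand pays for the registers that hold an index; if $\varepsilon\le 1\le n/2$, it is at most a constant times the first summand, and the bound is $O\big((\log m+\log\frac n\varepsilon)\log\frac{n}{\delta\varepsilon}\big)$.) 2. (Relative accuracy.) For every $\varepsilon\in(0,1)$ there is a quantum algorithm that, on every array $A$, outputs with probability at least $1-\delta$ a real number $\widehat F$ with $(1-\varepsilon)\widehat F\le F_\infty(A)\le\widehat F$ and $|\widehat F-F_\infty(A)|\le\varepsilon F_\infty(A)$, and that uses at most $$C\,\frac{m^{3/2}}{\varepsilon}\Big(\log\frac{m}{\delta\varepsilon}\Big)^{k}$$ queries, i.e. $\tilde O(m^{3/2}/\varepsilon)$ queries, and at most $$C\big(\log\tfrac m\varepsilon+\log n\big)\log\tfrac{n}{\delta\varepsilon}$$ qubits. -/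

import Mathlib

/-- Classical states (standard basis states) of `w` qubits. -/
abbrev Bits (w : ℕ) : Type := Fin w → Bool

/-- The action on standard basis states of the oracle of an array `A` with `n` entries in
`{0, …, m - 1}`: `|i⟩|b⟩ ↦ |i⟩|b ⊕ A[i]⟩`. The map `e` tells which wires hold the
`⌈log₂ n⌉`-bit index `i` and which wires hold the `⌈log₂ m⌉`-bit value `b`
(least significant bit first). Nothing happens if the index register holds a number `i ≥ n`. -/
def oracleMap {n m w : ℕ} (e : Fin (Nat.clog 2 n) ⊕ Fin (Nat.clog 2 m) ↪ Fin w)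
    (A : Fin n → Fin m) (x : Bits w) : Bits w :=
  if h : Nat.ofBits (fun k => x (e (Sum.inl k))) < n then
    fun j => Bool.xor (x j)
      (decide (∃ k : Fin (Nat.clog 2 m), e (Sum.inr k) = j ∧
        (A ⟨Nat.ofBits (fun k => x (e (Sum.inl k))), h⟩ : ℕ).testBit k = true))
  else x

/-- The oracle as an operator on the state space of `w` qubits. -/
def oracleMatrix {n m w : ℕ} (e : Fin (Nat.clog 2 n) ⊕ Fin (Nat.clog 2 m) ↪ Fin w)
    (A : Fin n → Fin m) : Matrix (Bits w) (Bits w) ℂ :=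
  Matrix.of fun y x => if y = oracleMap e A x then 1 else 0

/-- One step of a quantum query algorithm on `w` qubits: a unitary that does not depend on the
array, a measurement of one qubit in the standard basis (the outcome stays in that qubit), a reset
of one qubit to `|0⟩`, or one query to the array. -/
inductive QStep (n m w : ℕ) : Type
  | gate (U : Matrix.unitaryGroup (Bits w) ℂ) : QStep n m w
  | measure (j : Fin w) : QStep n m w
  | reset (j : Fin w) : QStep n m w
  | query (e : Fin (Nat.clog 2 n) ⊕ Fin (Nat.clog 2 m) ↪ Fin w) : QStep n m w

/-- Whether a step is a query. -/
def QStep.isQuery {n m w : ℕ} : QStep n m w → Bool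
  | .query _ => true
  | _ => false

/-- The effect of a step on the density matrix of the `w` qubits, for the input array `A`. -/
def QStep.apply {n m w : ℕ} (A : Fin n → Fin m) (ρ : Matrix (Bits w) (Bits w) ℂ) :
    QStep n m w → Matrix (Bits w) (Bits w) ℂ
  | .gate U => (U : Matrix (Bits w) (Bits w) ℂ) * ρ * (U : Matrix (Bits w) (Bits w) ℂ).conjTranspose
  | .measure j => Matrix.of fun x y => if x j = y j then ρ x y else 0
  | .reset j => Matrix.of fun x y =>
      if x j = false ∧ y j = false then
        ∑ b : Bool, ρ (Function.update x j b) (Function.update y j b)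
      else 0
  | .query e => oracleMatrix e A * ρ * (oracleMatrix e A).conjTranspose

/-- A quantum query algorithm for arrays with `n` entries in `{0, …, m - 1}`. All of its memory,
quantum or classical and including the registers of the oracle, is held in `qubits` many qubits,
initially `|0 … 0⟩`. At the end all qubits are measured in the standard basis and the real number
`output x` is returned, where `x` is the outcome. -/
structure QueryAlgorithm (n m : ℕ) : Type where
  qubits : ℕ
  steps : List (QStep n m qubits)
  output : Bits qubits → ℝ

namespace QueryAlgorithm

variable {n m : ℕ}

/-- The number of queries made by the algorithm. -/
def queries (P : QueryAlgorithm n m) : ℕ := P.steps.countP QStep.isQuery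

/-- The density matrix before the final measurement, on the input array `A`. -/
noncomputable def finalState (P : QueryAlgorithm n m) (A : Fin n → Fin m) :
    Matrix (Bits P.qubits) (Bits P.qubits) ℂ :=
  P.steps.foldl (QStep.apply A) (Matrix.single (fun _ => false) (fun _ => false) 1)

open Classical in
/-- The probability that, on the input array `A`, the returned number lies in `S`. -/
noncomputable def prob (P : QueryAlgorithm n m) (A : Fin n → Fin m) (S : Set ℝ) : ℝ :=
  ∑ x : Bits P.qubits, if P.output x ∈ S then (P.finalState A x x).re else 0

end QueryAlgorithm

/-- The modal frequency `F_∞` of an array: the number of occurrences of its most frequent value. -/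
def modalFrequency {n m : ℕ} (A : Fin n → Fin m) : ℕ :=
  Finset.univ.sup fun v : Fin m => (Finset.univ.filter fun i : Fin n => A i = v).card

open Matrix

set_option linter.unusedSectionVars false
set_option synthInstance.maxSize 1000

/-! Write Φ for the modal frequency divided by n. The algorithm finds Φ by binary search, and each
comparison with a threshold θ is a nested amplitude estimation.

In the inner level, the uniform superposition of the entries |i, A[i]⟩ is prepared. Controlled by
the value A[i], phase estimation is run on the Grover operator that marks the indices with that
value. This operator rotates by twice the angle whose squared sine is the relative frequency of
A[i]. An entry is accepted if the resulting estimate is at least θ. If Φ is below θ by a margin Δ,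
almost no weight is accepted. If Φ is above θ by Δ, the entries holding a modal value alone
contribute accepted weight at least Φ/2 (`entryEstimation_accept_le`, `le_entryEstimation_accept`).
In the outer level, amplitude estimation tells accepted amplitude at least 2s from at most s/2,
provided that Φ ≥ 8s² (`thresholdTest_reject_le`, `thresholdTest_accept_le`).

Up to logarithms, the inner level costs 1/Δ queries and repeats 1/s times. So precision of order 1/N
for all Φ ≥ 1/K costs about N√K queries (`exists_estimator`). Additive accuracy takes K and N of
order n/ε. Relative accuracy takes K = m, because Φ ≥ 1/m always holds by pigeonhole, and N of order
m/ε.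

Errors are made small inside a single phase register and not by repetition. Phase estimation starts
from a window state whose amplitudes are the coefficients of (1 + x + … + x^(M-1))^r. An outcome at
distance 2/M or more then has probability at most 4^(-r), on a register of about log(rM) qubits
(`exists_window`, `phaseEstimation_outcome_le`). After each comparison everything is measured, and
all wires except the recorded results are reset. The state is therefore a classical distribution
between rounds, and the failure probabilities add up (`exists_steps_rounds`). -/

theorem sum_norm_sq_eq_dotProduct {X : Type} [Fintype X] (ψ : X → ℂ) :
    ((∑ x, ‖ψ x‖ ^ 2 : ℝ) : ℂ) = star ψ ⬝ᵥ ψ := by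
  simp only [dotProduct, Pi.star_apply, RCLike.star_def, Complex.conj_mul']
  push_cast
  rfl

/-! ### Elementary unitaries: permutations, sign changes, reflections, controlled gates, state
preparation. -/

section Gates

variable {X Y Z T : Type} [Fintype X] [DecidableEq X] [Fintype Y] [DecidableEq Y]
  [Fintype Z] [DecidableEq Z] [Fintype T] [DecidableEq T]

theorem sum_norm_sq_mulVec (U : unitaryGroup X ℂ) (ψ : X → ℂ) :
    ∑ x, ‖((U : Matrix X X ℂ) *ᵥ ψ) x‖ ^ 2 = ∑ x, ‖ψ x‖ ^ 2 := by
  have h : star ((U : Matrix X X ℂ) *ᵥ ψ) ⬝ᵥ ((U : Matrix X X ℂ) *ᵥ ψ) = star ψ ⬝ᵥ ψ := by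
    rw [star_mulVec, dotProduct_mulVec, vecMul_vecMul, ← star_eq_conjTranspose,
      UnitaryGroup.star_mul_self, vecMul_one]
  exact_mod_cast (sum_norm_sq_eq_dotProduct _).trans (h.trans (sum_norm_sq_eq_dotProduct ψ).symm)

theorem coe_mul_mulVec (U V : unitaryGroup X ℂ) (ψ : X → ℂ) :
    ((U * V : unitaryGroup X ℂ) : Matrix X X ℂ) *ᵥ ψ
      = (U : Matrix X X ℂ) *ᵥ ((V : Matrix X X ℂ) *ᵥ ψ) := by
  rw [mulVec_mulVec]; rfl

/-- The standard basis state `x`. -/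
def basisState (x : X) : X → ℂ := Pi.single x 1

theorem sum_norm_sq_basisState (x : X) : ∑ y, ‖basisState x y‖ ^ 2 = 1 := by
  rw [Finset.sum_eq_single x] <;> simp +contextual [basisState]

theorem mulVec_basisState (U : Matrix X X ℂ) (x y : X) : (U *ᵥ basisState x) y = U y x := by
  simp [basisState]

/-- The unitary permuting the basis states by `σ`. -/
def permGate (σ : Equiv.Perm X) : unitaryGroup X ℂ :=
  ⟨of fun y x => if y = σ x then 1 else 0, by
    rw [mem_unitaryGroup_iff]
    ext a b
    simp only [star_eq_conjTranspose, mul_apply, of_apply, conjTranspose_apply, one_apply]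
    rw [Finset.sum_eq_single (σ.symm a)]
    · by_cases h : a = b
      · simp [h]
      · simp [h, Ne.symm h]
    · intro x _ hx
      have : a ≠ σ x := fun h => hx (by simp [h])
      simp [this]
    · simp⟩

theorem permGate_mulVec (σ : Equiv.Perm X) (ψ : X → ℂ) (x : X) :
    ((permGate σ : Matrix X X ℂ) *ᵥ ψ) x = ψ (σ.symm x) := by
  simp only [permGate, mulVec, dotProduct, of_apply]
  rw [Finset.sum_eq_single (σ.symm x)]
  · simp
  · intro y _ hy
    have : x ≠ σ y := fun h => hy (by simp [h])
    simp [this]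
  · simp

/-- The unitary changing the sign of the basis states in `P`. -/
def signGate (P : X → Bool) : unitaryGroup X ℂ :=
  ⟨diagonal fun x => if P x then -1 else 1, by
    rw [mem_unitaryGroup_iff, star_eq_conjTranspose, diagonal_conjTranspose, diagonal_mul_diagonal,
      ← diagonal_one]
    congr 1
    ext x
    by_cases h : P x <;> simp [h]⟩

theorem signGate_mulVec (P : X → Bool) (ψ : X → ℂ) (x : X) :
    ((signGate P : Matrix X X ℂ) *ᵥ ψ) x = if P x then -ψ x else ψ x := by
  simp only [signGate, mulVec_diagonal]
  split_ifs <;> simp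

theorem ext_mulVec {U V : unitaryGroup X ℂ}
    (h : ∀ ψ, (U : Matrix X X ℂ) *ᵥ ψ = (V : Matrix X X ℂ) *ᵥ ψ) : U = V := by
  apply Subtype.ext
  exact ext_of_mulVec_single fun i => h _

/-- Compute, mark, uncompute: this turns two oracle queries into a phase oracle for a predicate of
the queried value. -/
theorem permGate_mul_signGate_mul (σ : Equiv.Perm X) (P : X → Bool) (h : σ * σ = 1) :
    permGate σ * signGate P * permGate σ = signGate (P ∘ σ) := by
  have hs : σ.symm = σ := by
    rw [← Equiv.Perm.inv_def]; exact inv_eq_of_mul_eq_one_left h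
  apply ext_mulVec
  intro ψ
  ext x
  simp only [coe_mul_mulVec, permGate_mulVec, signGate_mulVec, hs, Function.comp_apply]
  rw [← Equiv.Perm.mul_apply, h, Equiv.Perm.one_apply]

theorem permGate_mul_self (σ : Equiv.Perm X) (h : σ * σ = 1) :
    permGate σ * permGate σ = 1 := by
  have hs : σ.symm = σ := by
    rw [← Equiv.Perm.inv_def]; exact inv_eq_of_mul_eq_one_left h
  apply ext_mulVec
  intro ψ
  ext x
  simp only [coe_mul_mulVec, permGate_mulVec, hs]
  rw [← Equiv.Perm.mul_apply, h]
  simp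

/-- The reflection `2|ψ⟩⟨ψ| - 1` about a unit vector. -/
def reflGate (ψ : X → ℂ) (h : ∑ x, ‖ψ x‖ ^ 2 = 1) : unitaryGroup X ℂ :=
  ⟨(2 : ℂ) • vecMulVec ψ (star ψ) - 1, by
    have h1 : star ψ ⬝ᵥ ψ = 1 := by rw [← sum_norm_sq_eq_dotProduct, h]; simp
    rw [mem_unitaryGroup_iff, star_eq_conjTranspose]
    have : ((2 : ℂ) • vecMulVec ψ (star ψ) - 1)ᴴ = (2 : ℂ) • vecMulVec ψ (star ψ) - 1 := by
      simp [conjTranspose_sub, conjTranspose_smul, conjTranspose_vecMulVec]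
    rw [this, sub_mul, mul_sub, smul_mul_smul_comm, vecMulVec_mul_vecMulVec, h1]
    simp only [mul_one, one_mul, one_smul]
    module⟩

theorem reflGate_mulVec (ψ φ : X → ℂ) (h : ∑ x, ‖ψ x‖ ^ 2 = 1) :
    (reflGate ψ h : Matrix X X ℂ) *ᵥ φ = fun x => 2 * (star ψ ⬝ᵥ φ) * ψ x - φ x := by
  ext x
  simp only [reflGate, sub_mulVec, smul_mulVec, vecMulVec_mulVec, one_mulVec]
  simp only [Pi.sub_apply, Pi.smul_apply, smul_eq_mul, MulOpposite.smul_eq_mul_unop,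
    MulOpposite.unop_op]
  ring

/-- Controlled unitaries: on `Z × T`, apply `f t` to the first register. -/
def ctrl : (T → unitaryGroup Z ℂ) →* unitaryGroup (Z × T) ℂ where
  toFun f := ⟨blockDiagonal fun t => (f t : Matrix Z Z ℂ), by
    rw [mem_unitaryGroup_iff, star_eq_conjTranspose, blockDiagonal_conjTranspose,
      ← blockDiagonal_mul, ← blockDiagonal_one]
    refine congrArg blockDiagonal (funext fun t => ?_)
    rw [← star_eq_conjTranspose]
    exact mem_unitaryGroup_iff.1 (f t).2⟩
  map_one' := Subtype.ext blockDiagonal_one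
  map_mul' f g := Subtype.ext
    (blockDiagonal_mul (fun t => (f t : Matrix Z Z ℂ)) fun t => (g t : Matrix Z Z ℂ))

theorem ctrl_mulVec (f : T → unitaryGroup Z ℂ) (ψ : Z × T → ℂ) (z : Z) (t : T) :
    ((ctrl f : Matrix (Z × T) (Z × T) ℂ) *ᵥ ψ) (z, t)
      = ((f t : Matrix Z Z ℂ) *ᵥ fun z' => ψ (z', t)) z := by
  simp [ctrl, mulVec, dotProduct, blockDiagonal_apply, Fintype.sum_prod_type]

theorem ctrl_apply (f : T → unitaryGroup Z ℂ) (z z' : Z) (t t' : T) :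
    (ctrl f : Matrix (Z × T) (Z × T) ℂ) (z, t) (z', t')
      = if t = t' then (f t : Matrix Z Z ℂ) z z' else 0 := by
  simp [ctrl, blockDiagonal_apply]

/-- A unitary applied to the second register. -/
def liftRight (F : unitaryGroup Y ℂ) : unitaryGroup (Z × Y) ℂ :=
  ⟨kroneckerMap (· * ·) (1 : Matrix Z Z ℂ) (F : Matrix Y Y ℂ), by
    rw [mem_unitaryGroup_iff, star_eq_conjTranspose, conjTranspose_kronecker, ← mul_kronecker_mul,
      ← star_eq_conjTranspose, ← star_eq_conjTranspose, mem_unitaryGroup_iff.1 F.2]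
    simp⟩

theorem liftRight_mulVec (F : unitaryGroup Y ℂ) (ψ : Z × Y → ℂ) (z : Z) (y : Y) :
    (((liftRight F : unitaryGroup (Z × Y) ℂ) : Matrix (Z × Y) (Z × Y) ℂ) *ᵥ ψ) (z, y)
      = ∑ k, (F : Matrix Y Y ℂ) y k * ψ (z, k) := by
  simp only [liftRight, mulVec, dotProduct, kroneckerMap_apply, one_apply, Fintype.sum_prod_type,
    ite_mul, one_mul, zero_mul]
  rw [Finset.sum_eq_single z] <;> simp +contextual [eq_comm]

/-- A unit vector extends to an orthonormal basis indexed by `X` with the vector at position `x₀`.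
The change of basis is the gate. -/
theorem exists_prepGate (x₀ : X) (ψ : X → ℂ) (h : ∑ x, ‖ψ x‖ ^ 2 = 1) :
    ∃ U : unitaryGroup X ℂ, (U : Matrix X X ℂ) *ᵥ basisState x₀ = ψ := by
  have hn : ‖(WithLp.toLp 2 ψ : EuclideanSpace ℂ X)‖ = 1 := by
    rw [EuclideanSpace.norm_eq]; simp [h]
  have ho : Orthonormal ℂ (({x₀} : Set X).domRestrict
      (fun _ : X => (WithLp.toLp 2 ψ : EuclideanSpace ℂ X))) := by
    constructor
    · intro i; exact hn
    · intro i j hij; exact absurd (Subsingleton.elim i j) hij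
  obtain ⟨b, hb⟩ := ho.exists_orthonormalBasis_extension_of_card_eq (by simp)
  refine ⟨⟨_, (EuclideanSpace.basisFun X ℂ).toMatrix_orthonormalBasis_mem_unitary b⟩, ?_⟩
  ext y
  rw [mulVec_basisState]
  simp [Module.Basis.toMatrix_apply, hb x₀ rfl]

end Gates

/-! ### Phase estimation applied to a Grover operator. -/

section PhaseEstimation

variable {Y Z : Type} [Fintype Y] [DecidableEq Y] [Fintype Z] [DecidableEq Z]

/-- Phase estimation of `G`: the second register is prepared by `C`, controls a power of `G`, and
undergoes `F`. -/
def phaseEstimation (F C : unitaryGroup Y ℂ) (κ : Y → ℕ) (G : unitaryGroup Z ℂ) :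
    unitaryGroup (Z × Y) ℂ :=
  liftRight F * ctrl (fun y => G ^ κ y) * liftRight C

theorem phaseEstimation_mulVec (F C : unitaryGroup Y ℂ) (κ : Y → ℕ) (G : unitaryGroup Z ℂ)
    (ψ : Z → ℂ) (y₀ y : Y) (z : Z) :
    ((phaseEstimation F C κ G : Matrix (Z × Y) (Z × Y) ℂ) *ᵥ
        fun a => ψ a.1 * basisState y₀ a.2) (z, y)
      = ∑ k, (F : Matrix Y Y ℂ) y k * (C : Matrix Y Y ℂ) k y₀ *
          (((G ^ κ k : unitaryGroup Z ℂ) : Matrix Z Z ℂ) *ᵥ ψ) z := by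
  have h : (((liftRight C : unitaryGroup (Z × Y) ℂ) : Matrix (Z × Y) (Z × Y) ℂ) *ᵥ
      fun a => ψ a.1 * basisState y₀ a.2) = fun a => (C : Matrix Y Y ℂ) a.2 y₀ * ψ a.1 := by
    ext ⟨z, k⟩
    rw [liftRight_mulVec, Finset.sum_eq_single y₀] <;> simp +contextual [basisState]
  rw [phaseEstimation, coe_mul_mulVec, coe_mul_mulVec, h, liftRight_mulVec]
  refine Finset.sum_congr rfl fun k _ => ?_
  rw [ctrl_mulVec, mul_assoc]
  congr 1
  exact congrFun (mulVec_smul ((G ^ κ k : unitaryGroup Z ℂ) : Matrix Z Z ℂ)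
    ((C : Matrix Y Y ℂ) k y₀) ψ) z

/-- The orbit of ψ stays in the plane spanned by its marked and unmarked parts, where the Grover
operator rotates by 2θ. Dividing by sin θ and cos θ normalises these parts. -/
theorem grover_pow_mulVec (ψ : Z → ℂ) (h : ∑ z, ‖ψ z‖ ^ 2 = 1) (P : Z → Bool) (θ : ℝ)
    (hθ : Real.sin θ ^ 2 = ∑ z with P z, ‖ψ z‖ ^ 2) (k : ℕ) (z : Z) :
    ((((reflGate ψ h * signGate P) ^ k : unitaryGroup Z ℂ) : Matrix Z Z ℂ) *ᵥ ψ) z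
      = ((if P z then Real.sin ((2 * k + 1) * θ) / Real.sin θ
          else Real.cos ((2 * k + 1) * θ) / Real.cos θ : ℝ) : ℂ) * ψ z := by
  have hc : Real.cos θ ^ 2 = ∑ z with ¬ P z, ‖ψ z‖ ^ 2 := by
    have := Finset.sum_filter_add_sum_filter_not Finset.univ (fun z => P z = true)
      (fun z => ‖ψ z‖ ^ 2)
    rw [← hθ, h] at this
    linarith [Real.sin_sq_add_cos_sq θ]
  -- In the degenerate cases the quotient takes the default value 0, which is harmless because the
  -- corresponding part of ψ vanishes.
  have h0 : ∀ z, P z → Real.sin θ = 0 → ψ z = 0 := by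
    intro z hz h0
    rw [h0, zero_pow two_ne_zero, eq_comm, Finset.sum_eq_zero_iff_of_nonneg
      (fun _ _ => by positivity)] at hθ
    simpa using hθ z (by simp [hz])
  have h1 : ∀ z, ¬ P z → Real.cos θ = 0 → ψ z = 0 := by
    intro z hz h0
    rw [h0, zero_pow two_ne_zero, eq_comm, Finset.sum_eq_zero_iff_of_nonneg
      (fun _ _ => by positivity)] at hc
    simpa using hc z (by simp [hz])
  induction k generalizing z with
  | zero =>
    by_cases hz : P z
    · by_cases hs : Real.sin θ = 0
      · simp [h0 z hz hs]
      · simp [hz, div_self hs, -Complex.ofReal_sin]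
    · by_cases hs : Real.cos θ = 0
      · simp [h1 z hz hs]
      · simp [hz, div_self hs, -Complex.ofReal_cos]
  | succ k ih =>
    set s := Real.sin ((2 * k + 1) * θ) with hs
    set c := Real.cos ((2 * k + 1) * θ) with hcc
    -- The overlap with ψ after the sign change is cos((2k+1)θ + θ). With it, the reflection becomes
    -- the sum formulas `a1` and `a2` below.
    have hdot : star ψ ⬝ᵥ (fun z => if P z then
        -(((if P z then s / Real.sin θ else c / Real.cos θ : ℝ) : ℂ) * ψ z)
        else ((if P z then s / Real.sin θ else c / Real.cos θ : ℝ) : ℂ) * ψ z)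
        = ((Real.cos ((2 * k + 2) * θ) : ℝ) : ℂ) := by
      have e : ∀ z, star ψ z * (if P z then
          -(((if P z then s / Real.sin θ else c / Real.cos θ : ℝ) : ℂ) * ψ z)
          else ((if P z then s / Real.sin θ else c / Real.cos θ : ℝ) : ℂ) * ψ z)
          = ((if P z then -(s / Real.sin θ) * ‖ψ z‖ ^ 2
              else (c / Real.cos θ) * ‖ψ z‖ ^ 2 : ℝ) : ℂ) := by
        intro z
        have : star ψ z * ψ z = ((‖ψ z‖ ^ 2 : ℝ) : ℂ) := by
          simp [Complex.conj_mul']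
        split_ifs <;> push_cast at this ⊢ <;> rw [← this] <;> ring
      simp only [dotProduct, e]
      rw [← Complex.ofReal_sum, Finset.sum_ite, ← Finset.mul_sum, ← Finset.mul_sum, ← hθ, ← hc]
      congr 1
      have e1 : s / Real.sin θ * Real.sin θ ^ 2 = s * Real.sin θ := by
        by_cases h : Real.sin θ = 0
        · simp [h]
        · field_simp
      have e2 : c / Real.cos θ * Real.cos θ ^ 2 = c * Real.cos θ := by
        by_cases h : Real.cos θ = 0
        · simp [h]
        · field_simp
      rw [neg_mul, e1, e2, show (2 * k + 2 : ℝ) * θ = (2 * k + 1) * θ + θ by ring, Real.cos_add]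
      ring
    have hstep : ((((reflGate ψ h * signGate P) ^ k : unitaryGroup Z ℂ) : Matrix Z Z ℂ) *ᵥ ψ)
      = fun z => ((if P z then s / Real.sin θ else c / Real.cos θ : ℝ) : ℂ) * ψ z := funext ih
    rw [pow_succ', coe_mul_mulVec, hstep, coe_mul_mulVec, reflGate_mulVec,
      funext (signGate_mulVec P _), hdot]
    have a1 : Real.sin ((2 * (k + 1 : ℕ) + 1) * θ)
        = s + 2 * Real.cos ((2 * k + 2) * θ) * Real.sin θ := by
      rw [hs, show (2 * (k + 1 : ℕ) + 1 : ℝ) * θ = (2 * k + 2) * θ + θ by push_cast; ring,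
        show (2 * k + 1 : ℝ) * θ = (2 * k + 2) * θ - θ by ring, Real.sin_add, Real.sin_sub]
      ring
    have a2 : Real.cos ((2 * (k + 1 : ℕ) + 1) * θ)
        = 2 * Real.cos ((2 * k + 2) * θ) * Real.cos θ - c := by
      rw [hcc, show (2 * (k + 1 : ℕ) + 1 : ℝ) * θ = (2 * k + 2) * θ + θ by push_cast; ring,
        show (2 * k + 1 : ℝ) * θ = (2 * k + 2) * θ - θ by ring, Real.cos_add, Real.cos_sub]
      ring
    rw [a1, a2]
    by_cases hz : P z
    · by_cases hs : Real.sin θ = 0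
      · simp [h0 z hz hs]
      · simp only [hz, if_true]
        rw [add_div, mul_div_assoc _ (Real.sin θ), div_self hs]
        push_cast
        ring
    · by_cases hs : Real.cos θ = 0
      · simp [h1 z hz hs]
      · simp only [hz, Bool.false_eq_true, if_false]
        rw [sub_div, mul_div_assoc _ (Real.cos θ), div_self hs]
        push_cast
        ring

/-- This replaces the decomposition of ψ into two eigenvectors of phases ±2θ. With a and b the sine
and cosine sums, b ± ia equals e^(±iθ) times the exponential sum at ±θ, and the parallelogram law
gives |a|² + |b|². Only an inequality is claimed, since a marked or unmarked part may be missing. -/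
theorem grover_sum_norm_sq_le {K : Type} [Fintype K] (ψ : Z → ℂ) (h : ∑ z, ‖ψ z‖ ^ 2 = 1)
    (P : Z → Bool) (θ : ℝ) (hθ : Real.sin θ ^ 2 = ∑ z with P z, ‖ψ z‖ ^ 2) (κ : K → ℕ)
    (f : K → ℂ) :
    ∑ z, ‖∑ k, f k *
      ((((reflGate ψ h * signGate P) ^ κ k : unitaryGroup Z ℂ) : Matrix Z Z ℂ) *ᵥ ψ) z‖ ^ 2
      ≤ (‖∑ k, f k * Complex.exp (2 * κ k * θ * Complex.I)‖ ^ 2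
        + ‖∑ k, f k * Complex.exp (2 * κ k * (-θ : ℝ) * Complex.I)‖ ^ 2) / 2 := by
  set a := ∑ k, f k * ((Real.sin ((2 * κ k + 1) * θ) : ℝ) : ℂ) with ha
  set b := ∑ k, f k * ((Real.cos ((2 * κ k + 1) * θ) : ℝ) : ℂ) with hb
  have hc : Real.cos θ ^ 2 = ∑ z with ¬ P z, ‖ψ z‖ ^ 2 := by
    have := Finset.sum_filter_add_sum_filter_not Finset.univ (fun z => P z = true)
      (fun z => ‖ψ z‖ ^ 2)
    rw [← hθ, h] at this
    linarith [Real.sin_sq_add_cos_sq θ]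
  have e1 : ∀ z, ‖∑ k, f k *
      ((((reflGate ψ h * signGate P) ^ κ k : unitaryGroup Z ℂ) : Matrix Z Z ℂ) *ᵥ ψ) z‖ ^ 2
      = if P z then ‖a‖ ^ 2 / Real.sin θ ^ 2 * ‖ψ z‖ ^ 2
        else ‖b‖ ^ 2 / Real.cos θ ^ 2 * ‖ψ z‖ ^ 2 := by
    intro z
    simp only [grover_pow_mulVec ψ h P θ hθ]
    split_ifs with hz
    · have : ∑ k, f k * (((Real.sin ((2 * κ k + 1) * θ) / Real.sin θ : ℝ) : ℂ) * ψ z)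
          = a / (Real.sin θ : ℝ) * ψ z := by
        rw [ha, Finset.sum_div, Finset.sum_mul]
        refine Finset.sum_congr rfl fun k _ => ?_
        push_cast
        ring
      rw [this, norm_mul, norm_div, mul_pow, div_pow, Complex.norm_real, Real.norm_eq_abs, sq_abs]
    · have : ∑ k, f k * (((Real.cos ((2 * κ k + 1) * θ) / Real.cos θ : ℝ) : ℂ) * ψ z)
          = b / (Real.cos θ : ℝ) * ψ z := by
        rw [hb, Finset.sum_div, Finset.sum_mul]
        refine Finset.sum_congr rfl fun k _ => ?_
        push_cast
        ring
      rw [this, norm_mul, norm_div, mul_pow, div_pow, Complex.norm_real, Real.norm_eq_abs, sq_abs]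
  simp only [e1]
  rw [Finset.sum_ite, ← Finset.mul_sum, ← Finset.mul_sum, ← hθ, ← hc]
  have e2 : ‖a‖ ^ 2 / Real.sin θ ^ 2 * Real.sin θ ^ 2 ≤ ‖a‖ ^ 2 :=
    by
    by_cases h : Real.sin θ = 0
    · simp [h]
    · rw [div_mul_cancel₀ _ (pow_ne_zero 2 h)]
  have e3 : ‖b‖ ^ 2 / Real.cos θ ^ 2 * Real.cos θ ^ 2 ≤ ‖b‖ ^ 2 :=
    by
    by_cases h : Real.cos θ = 0
    · simp [h]
    · rw [div_mul_cancel₀ _ (pow_ne_zero 2 h)]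
  have e4 : ‖∑ k, f k * Complex.exp (2 * κ k * θ * Complex.I)‖ = ‖b + Complex.I * a‖ := by
    have : b + Complex.I * a = Complex.exp (θ * Complex.I) *
        ∑ k, f k * Complex.exp (2 * κ k * θ * Complex.I) := by
      rw [ha, hb, Finset.mul_sum, Finset.mul_sum, ← Finset.sum_add_distrib]
      refine Finset.sum_congr rfl fun k _ => ?_
      rw [mul_left_comm (Complex.exp _), ← Complex.exp_add,
        show (θ * Complex.I + 2 * κ k * θ * Complex.I : ℂ)
          = (((2 * κ k + 1) * θ : ℝ) : ℂ) * Complex.I by push_cast; ring, Complex.exp_mul_I]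
      push_cast
      ring
    rw [this, norm_mul, Complex.norm_exp_ofReal_mul_I, one_mul]
  have e5 : ‖∑ k, f k * Complex.exp (2 * κ k * (-θ : ℝ) * Complex.I)‖
      = ‖b - Complex.I * a‖ := by
    have : b - Complex.I * a = Complex.exp ((-θ : ℝ) * Complex.I) *
        ∑ k, f k * Complex.exp (2 * κ k * (-θ : ℝ) * Complex.I) := by
      rw [ha, hb, Finset.mul_sum, Finset.mul_sum, ← Finset.sum_sub_distrib]
      refine Finset.sum_congr rfl fun k _ => ?_
      rw [mul_left_comm (Complex.exp _), ← Complex.exp_add,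
        show ((-θ : ℝ) * Complex.I + 2 * κ k * (-θ : ℝ) * Complex.I : ℂ)
          = ((-((2 * κ k + 1) * θ) : ℝ) : ℂ) * Complex.I by push_cast; ring, Complex.exp_mul_I,
        ← Complex.ofReal_cos, ← Complex.ofReal_sin, Real.cos_neg, Real.sin_neg]
      push_cast
      ring
    rw [this, norm_mul, Complex.norm_exp_ofReal_mul_I, one_mul]
  have e6 := parallelogram_law_with_norm ℝ b (Complex.I * a)
  rw [norm_mul, Complex.norm_I, one_mul] at e6
  rw [e4, e5]
  nlinarith

/-- The identity sin²α - sin²θ = -sin(θ-α) sin(θ+α) is divided by |sin α| + sin θ, which is at least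
|sin(θ+α)|. Hence a wrong estimate of the amplitude forces a wrong phase, for both signs of θ. -/
theorem abs_sub_le_abs_sin_sub (α θ : ℝ) (hθ : 0 ≤ Real.sin θ) :
    |(|Real.sin α| - Real.sin θ)| ≤ |Real.sin (θ - α)| := by
  have h1 : (|Real.sin α| - Real.sin θ) * (|Real.sin α| + Real.sin θ)
      = - (Real.sin (θ - α) * Real.sin (θ + α)) := by
    rw [Real.sin_add, Real.sin_sub]
    have := sq_abs (Real.sin α)
    nlinarith [Real.sin_sq_add_cos_sq α, Real.sin_sq_add_cos_sq θ]
  have h2 : |Real.sin (θ + α)| ≤ |Real.sin α| + Real.sin θ := by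
    rw [Real.sin_add]
    refine (abs_add_le _ _).trans ?_
    rw [abs_mul, abs_mul, abs_of_nonneg hθ]
    nlinarith [Real.abs_cos_le_one α, Real.abs_cos_le_one θ, abs_nonneg (Real.sin α)]
  by_cases h0 : |Real.sin α| + Real.sin θ = 0
  · have : |Real.sin α| = 0 := by linarith [abs_nonneg (Real.sin α)]
    have h3 : Real.sin θ = 0 := by linarith [abs_nonneg (Real.sin α)]
    simp [this, h3]
  · have hp : 0 < |Real.sin α| + Real.sin θ :=
      lt_of_le_of_ne (add_nonneg (abs_nonneg _) hθ) (Ne.symm h0)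
    refine le_of_mul_le_mul_right ?_ hp
    have h4 := congrArg abs h1
    rw [abs_mul, abs_neg, abs_mul, abs_of_pos hp] at h4
    rw [h4]
    exact mul_le_mul_of_nonneg_left h2 (abs_nonneg _)

/-- The angle that belongs to the outcome `j` of phase estimation with `D` outcomes. -/
noncomputable def phaseAngle (D j : ℕ) : ℝ := Real.pi * j / D

/-- The amplitude of the outcome `y` of phase estimation on an eigenvector of phase `2 θ` is small
unless `θ` is near the angle of `y`. -/
def IsPhaseEstimator (κ : Y → ℕ) (F C : unitaryGroup Y ℂ) (y₀ : Y) (D M r : ℕ) : Prop :=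
  ∀ (y : Y) (θ : ℝ), (M * |Real.sin (θ - phaseAngle D (κ y))|) ^ r *
    ‖∑ k, (F : Matrix Y Y ℂ) y k * (C : Matrix Y Y ℂ) k y₀ *
      Complex.exp (2 * κ k * θ * Complex.I)‖ ≤ 1

/-- The amplitude to be estimated is sin θ = √p. An outcome at distance at least 2/M from it has
amplitude at most 2^(-r) at each of the phases ±2θ, hence probability at most 4^(-r). -/
theorem phaseEstimation_outcome_le {κ : Y → ℕ} {F C : unitaryGroup Y ℂ} {y₀ : Y} {D M r : ℕ}
    (hE : IsPhaseEstimator κ F C y₀ D M r) (ψ : Z → ℂ) (h : ∑ z, ‖ψ z‖ ^ 2 = 1) (P : Z → Bool)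
    (y : Y)
    (hy : 2 ≤ M * |(|Real.sin (phaseAngle D (κ y))| - √(∑ z with P z, ‖ψ z‖ ^ 2))|) :
    ∑ z, ‖((phaseEstimation F C κ (reflGate ψ h * signGate P) : Matrix (Z × Y) (Z × Y) ℂ) *ᵥ
        fun a => ψ a.1 * basisState y₀ a.2) (z, y)‖ ^ 2 ≤ (1 / 4) ^ r := by
  set p := ∑ z with P z, ‖ψ z‖ ^ 2 with hp
  have hp0 : 0 ≤ p := Finset.sum_nonneg fun _ _ => by positivity
  have hp1 : p ≤ 1 := by
    rw [hp, ← h]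
    exact Finset.sum_le_sum_of_subset_of_nonneg (Finset.subset_univ _) fun _ _ _ => by positivity
  set θ := Real.arcsin (√p) with hθ
  have hs : Real.sin θ = √p := Real.sin_arcsin
    (by linarith [Real.sqrt_nonneg p]) (Real.sqrt_le_one.2 hp1)
  have hs2 : Real.sin θ ^ 2 = p := by rw [hs, Real.sq_sqrt hp0]
  simp only [phaseEstimation_mulVec]
  refine (grover_sum_norm_sq_le ψ h P θ hs2 κ _).trans ?_
  have key : ∀ t : ℝ, 2 ≤ M * |Real.sin (t - phaseAngle D (κ y))| →
      ‖∑ k, (F : Matrix Y Y ℂ) y k * (C : Matrix Y Y ℂ) k y₀ *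
      Complex.exp (2 * κ k * t * Complex.I)‖ ^ 2 ≤ (1 / 4) ^ r := by
    intro t ht
    have h1 := hE y t
    set N := ‖∑ k, (F : Matrix Y Y ℂ) y k * (C : Matrix Y Y ℂ) k y₀ *
      Complex.exp (2 * κ k * t * Complex.I)‖
    have h2 : (2 : ℝ) ^ r * N ≤ 1 :=
      (mul_le_mul_of_nonneg_right (pow_le_pow_left₀ (by norm_num) ht r) (norm_nonneg _)).trans h1
    have h3 : ((2 : ℝ) ^ r * N) ^ 2 ≤ 1 := pow_le_one₀ (by positivity) h2
    rw [mul_pow, ← pow_mul, mul_comm r, pow_mul] at h3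
    norm_num at h3
    rw [div_pow, one_pow, le_div_iff₀ (by positivity)]
    linarith
  have k1 := key θ (hy.trans (mul_le_mul_of_nonneg_left
    (by rw [← hs]; exact abs_sub_le_abs_sin_sub _ _ (hs ▸ Real.sqrt_nonneg _)) (by positivity)))
  have k2 := key (-θ) (hy.trans (mul_le_mul_of_nonneg_left (by
    have := abs_sub_le_abs_sin_sub (-phaseAngle D (κ y)) θ (hs ▸ Real.sqrt_nonneg _)
    rw [Real.sin_neg, abs_neg, hs] at this
    rwa [show -θ - phaseAngle D (κ y) = -(θ - -phaseAngle D (κ y)) by ring, Real.sin_neg (_ - _),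
      abs_neg]) (by positivity)))
  linarith

theorem phaseEstimation_bad_le {κ : Y → ℕ} {F C : unitaryGroup Y ℂ} {y₀ : Y} {D M r : ℕ}
    (hE : IsPhaseEstimator κ F C y₀ D M r) (ψ : Z → ℂ) (h : ∑ z, ‖ψ z‖ ^ 2 = 1) (P : Z → Bool)
    (B : Y → Bool) (hB : ∀ y, B y →
      2 ≤ M * |(|Real.sin (phaseAngle D (κ y))| - √(∑ z with P z, ‖ψ z‖ ^ 2))|) :
    ∑ a : Z × Y with B a.2,
      ‖((phaseEstimation F C κ (reflGate ψ h * signGate P) : Matrix (Z × Y) (Z × Y) ℂ) *ᵥ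
        fun a => ψ a.1 * basisState y₀ a.2) a‖ ^ 2 ≤ Fintype.card Y * (1 / 4) ^ r := by
  -- Union bound over the outcomes. The factor |Y| is affordable since 4^(-r) can be made
  -- polynomially small at logarithmic cost.
  rw [Finset.sum_filter, Fintype.sum_prod_type_right, ← nsmul_eq_mul, ← Finset.card_univ]
  refine Finset.sum_le_card_nsmul _ _ _ fun y _ => ?_
  by_cases hy : B y
  · simpa only [hy, if_true] using phaseEstimation_outcome_le hE ψ h P y (hB y hy)
  · simp [hy]

end PhaseEstimation

/-! ### Existence of a phase estimator with exponentially small tails. -/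

section EstimatorExistence

variable {Y : Type} [Fintype Y] [DecidableEq Y]

theorem sum_equiv_fin {Y M : Type} [Fintype Y] [AddCommMonoid M] {D : ℕ} (κ : Y ≃ Fin D) (f : ℕ → M) :
    ∑ k, f (κ k) = ∑ j ∈ Finset.range D, f j := by
  rw [Equiv.sum_comp κ (fun i => f i), Fin.sum_univ_eq_sum_range]

theorem exists_fourierGate {D : ℕ} (κ : Y ≃ Fin D) (hD : D ≠ 0) :
    ∃ F : unitaryGroup Y ℂ, ∀ y k, (F : Matrix Y Y ℂ) y k
      = Complex.exp (-(2 * Real.pi * Complex.I / D)) ^ ((κ y : ℕ) * κ k) / (√(D : ℝ) : ℝ) := by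
  set ζ := Complex.exp (-(2 * Real.pi * Complex.I / D)) with hζ
  have hprim : IsPrimitiveRoot ζ D := by
    rw [hζ, Complex.exp_neg]
    exact (Complex.isPrimitiveRoot_exp D hD).inv
  have hζ0 : ζ ≠ 0 := Complex.exp_ne_zero _
  have hconj : star ζ = ζ⁻¹ := by
    rw [hζ, RCLike.star_def, ← Complex.exp_conj, ← Complex.exp_neg]
    congr 1
    simp only [map_neg, map_div₀, map_mul, map_ofNat, Complex.conj_ofReal, Complex.conj_I,
      map_natCast]
    ring
  refine ⟨⟨of fun y k => ζ ^ ((κ y : ℕ) * κ k) / (√(D : ℝ) : ℝ), ?_⟩, fun _ _ => rfl⟩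
  rw [mem_unitaryGroup_iff]
  ext a b
  simp only [star_eq_conjTranspose, mul_apply, of_apply, conjTranspose_apply, star_div₀, star_pow,
    hconj, RCLike.star_def, Complex.conj_ofReal]
  have hDD : ((√(D : ℝ) : ℝ) : ℂ) * ((√(D : ℝ) : ℝ) : ℂ) = D := by
    rw [← Complex.ofReal_mul, Real.mul_self_sqrt (by positivity)]; simp
  have e : ∀ k, ζ ^ ((κ a : ℕ) * κ k) / ((√(D : ℝ) : ℝ) : ℂ) *
      (ζ⁻¹ ^ ((κ b : ℕ) * κ k) / ((√(D : ℝ) : ℝ) : ℂ))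
      = (ζ ^ (κ a : ℕ) * ζ⁻¹ ^ (κ b : ℕ)) ^ (κ k : ℕ) / D := by
    intro k
    rw [div_mul_div_comm, hDD, pow_mul, pow_mul, mul_pow]
  simp only [e]
  rw [← Finset.sum_div, sum_equiv_fin κ fun j => (ζ ^ (κ a : ℕ) * ζ⁻¹ ^ (κ b : ℕ)) ^ j]
  by_cases hab : a = b
  · subst hab
    rw [inv_pow, mul_inv_cancel₀ (pow_ne_zero _ hζ0)]
    simp [hD]
  · have hw : ζ ^ (κ a : ℕ) * ζ⁻¹ ^ (κ b : ℕ) ≠ 1 := by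
      intro h
      rw [inv_pow, mul_inv_eq_one₀ (pow_ne_zero _ hζ0)] at h
      have := hprim.pow_inj (κ a).2 (κ b).2 h
      exact hab (κ.injective (Fin.ext this))
    have hwD : (ζ ^ (κ a : ℕ) * ζ⁻¹ ^ (κ b : ℕ)) ^ D = 1 := by
      rw [mul_pow, ← pow_mul, ← pow_mul, mul_comm, pow_mul, mul_comm (κ a : ℕ), pow_mul,
        inv_pow, hprim.pow_eq_one, one_pow, mul_one, inv_pow, ← pow_mul, mul_comm, pow_mul,
        hprim.pow_eq_one, one_pow, inv_one]
    rw [geom_sum_eq hw, hwD]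
    simp [hab]

-- The window consists of the normalised coefficients of q = (1 + X + … + X^(M-1))^r. On the unit
-- circle the geometric sum has modulus at most 1/|sin β|, which controls the numerator. Since the
-- coefficients of q add up to q(1) = M^r, Cauchy–Schwarz bounds the normalisation from below by
-- M^r/√D.
open Polynomial in
theorem exists_window {D M r : ℕ} (hM : 1 ≤ M) (hD : r * M < D) :
    ∃ c : ℕ → ℝ, ∑ j ∈ Finset.range D, c j ^ 2 = 1 ∧ ∀ β : ℝ,
      (M * |Real.sin β|) ^ r *
        ‖∑ j ∈ Finset.range D, (c j : ℂ) * Complex.exp (2 * β * Complex.I) ^ j‖ ≤ √D := by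
  set q : ℝ[X] := (∑ j ∈ Finset.range M, X ^ j) ^ r with hq
  have hdeg : q.natDegree < D := by
    refine lt_of_le_of_lt ?_ hD
    refine natDegree_pow_le.trans (Nat.mul_le_mul_left r ?_)
    refine natDegree_sum_le_of_forall_le _ _ fun j hj => ?_
    rw [natDegree_X_pow]
    exact (Finset.mem_range.1 hj).le
  set N := ∑ j ∈ Finset.range D, q.coeff j ^ 2 with hN
  have hsum : ∑ j ∈ Finset.range D, q.coeff j = (M : ℝ) ^ r := by
    have := eval_eq_sum_range' hdeg (1 : ℝ)
    simp only [one_pow, mul_one] at this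
    rw [← this, hq]
    simp [eval_finsetSum]
  have hCS : ((M : ℝ) ^ r) ^ 2 ≤ D * N := by
    have := sq_sum_le_card_mul_sum_sq (s := Finset.range D) (f := fun j => q.coeff j)
    rwa [hsum, Finset.card_range] at this
  have hMr : 0 < (M : ℝ) ^ r := by positivity
  have hNpos : 0 < N := by
    by_contra h
    have : (D : ℝ) * N ≤ 0 := mul_nonpos_of_nonneg_of_nonpos (by positivity) (not_lt.1 h)
    nlinarith [pow_pos hMr 2]
  refine ⟨fun j => q.coeff j / √N, ?_, fun β => ?_⟩
  · simp only [div_pow, Real.sq_sqrt hNpos.le]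
    rw [← Finset.sum_div, div_self hNpos.ne']
  · set x := Complex.exp (2 * β * Complex.I) with hx
    have hev : ∑ j ∈ Finset.range D, ((q.coeff j / √N : ℝ) : ℂ) * x ^ j
        = (∑ j ∈ Finset.range M, x ^ j) ^ r / (√N : ℝ) := by
      have := eval_eq_sum_range' (p := q.map (algebraMap ℝ ℂ)) (n := D)
        (by rwa [natDegree_map]) x
      have h2 : (q.map (algebraMap ℝ ℂ)).eval x = (∑ j ∈ Finset.range M, x ^ j) ^ r := by
        simp [hq, Polynomial.map_sum, eval_finsetSum]
      rw [← h2, this, Finset.sum_div]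
      refine Finset.sum_congr rfl fun j _ => ?_
      rw [coeff_map]
      push_cast
      simp
      ring
    have hgeom : |Real.sin β| * ‖∑ j ∈ Finset.range M, x ^ j‖ ≤ 1 := by
      have h1 : ‖x - 1‖ = 2 * |Real.sin β| := by
        have : x - 1 = Complex.exp (β * Complex.I) * (2 * Complex.I * (Real.sin β : ℝ)) := by
          have h2 : x = Complex.exp (β * Complex.I) * Complex.exp (β * Complex.I) := by
            rw [hx, ← Complex.exp_add]; congr 1; ring
          have h3 : Complex.exp (β * Complex.I) * Complex.exp (-(β * Complex.I)) = 1 := by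
            rw [← Complex.exp_add]; simp
          rw [Complex.ofReal_sin, Complex.sin, h2, neg_mul]
          linear_combination (Complex.exp (β * Complex.I) ^ 2 - 1) * Complex.I_sq
            - Complex.I ^ 2 * h3
        rw [this, norm_mul, Complex.norm_exp_ofReal_mul_I, norm_mul, norm_mul, Complex.norm_I,
          Complex.norm_real, Real.norm_eq_abs]
        simp
      have h4 : ‖x‖ = 1 := by
        rw [hx, show (2 * β * Complex.I : ℂ) = ((2 * β : ℝ) : ℂ) * Complex.I by push_cast; ring,
          Complex.norm_exp_ofReal_mul_I]
      have h5 := congrArg norm (geom_sum_mul x M)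
      rw [norm_mul, h1] at h5
      have h6 : ‖x ^ M - 1‖ ≤ 2 := by
        refine (norm_sub_le _ _).trans ?_
        rw [norm_pow, h4]; norm_num
      nlinarith
    rw [hev, norm_div, norm_pow, Complex.norm_real, Real.norm_eq_abs, abs_of_nonneg
      (Real.sqrt_nonneg _), mul_pow, mul_div_assoc', mul_assoc, ← mul_pow,
      div_le_iff₀ (Real.sqrt_pos.2 hNpos), ← Real.sqrt_mul (by positivity)]
    refine (mul_le_of_le_one_right hMr.le (pow_le_one₀ (by positivity) hgeom)).trans ?_
    exact Real.le_sqrt_of_sq_le hCS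

theorem exists_phaseEstimator {D M r : ℕ} (κ : Y ≃ Fin D) (y₀ : Y) (hM : 1 ≤ M)
    (hD : r * M < D) :
    ∃ F C : unitaryGroup Y ℂ, IsPhaseEstimator (fun y => (κ y : ℕ)) F C y₀ D M r := by
  have hD0 : D ≠ 0 := by omega
  obtain ⟨F, hF⟩ := exists_fourierGate κ hD0
  obtain ⟨c, hc, hw⟩ := exists_window hM hD
  obtain ⟨C, hC⟩ := exists_prepGate y₀ (fun k : Y => ((c (κ k) : ℝ) : ℂ)) (by
    simp only [Complex.norm_real, Real.norm_eq_abs, sq_abs]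
    rw [sum_equiv_fin κ fun j => c j ^ 2, hc])
  have hC' : ∀ k, (C : Matrix Y Y ℂ) k y₀ = c (κ k) := fun k => by
    rw [← mulVec_basisState (C : Matrix Y Y ℂ) y₀ k, hC]
  refine ⟨F, C, fun y θ => ?_⟩
  -- The Fourier factor shifts the phase by the angle of the outcome, so the amplitude is the window
  -- polynomial at θ minus that angle. The remaining 1/√D cancels the √D of `exists_window`.
  have e : ∑ k, (F : Matrix Y Y ℂ) y k * (C : Matrix Y Y ℂ) k y₀ *
      Complex.exp (2 * (κ k : ℕ) * θ * Complex.I)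
      = (∑ j ∈ Finset.range D, (c j : ℂ) *
        Complex.exp (2 * ((θ - phaseAngle D (κ y) : ℝ)) * Complex.I) ^ j) / (√(D : ℝ) : ℝ) := by
    rw [← sum_equiv_fin κ fun j => (c j : ℂ) *
        Complex.exp (2 * ((θ - phaseAngle D (κ y) : ℝ)) * Complex.I) ^ j, Finset.sum_div]
    refine Finset.sum_congr rfl fun k _ => ?_
    rw [hF, hC', ← Complex.exp_nat_mul, ← Complex.exp_nat_mul, div_mul_eq_mul_div,
      div_mul_eq_mul_div, mul_right_comm, ← Complex.exp_add, mul_comm (c _ : ℂ)]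
    congr 3
    have : (D : ℂ) ≠ 0 := by exact_mod_cast hD0
    simp only [phaseAngle]
    push_cast
    field_simp
    ring
  rw [e, norm_div, Complex.norm_real, Real.norm_eq_abs, abs_of_nonneg (Real.sqrt_nonneg _),
    mul_div_assoc', div_le_one (by positivity)]
  exact hw _

end EstimatorExistence

/-! ### Counting queries in circuits with parameters; only the gates, never the queries, are
controlled. -/

section Computable

variable {𝒜 T T' Y Z : Type} [Fintype Y] [DecidableEq Y] [Fintype Z] [DecidableEq Z]

/-- `QueryComputable Q q f`: the unitaries `f t A` are computed by a circuit with `q` uses of the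
query `Q A`, whose other gates may depend on the parameter `t` but not on the input `A`. -/
inductive QueryComputable (Q : 𝒜 → unitaryGroup Z ℂ) : ℕ → (T → 𝒜 → unitaryGroup Z ℂ) → Prop
  | const (g : T → unitaryGroup Z ℂ) : QueryComputable Q 0 fun t _ => g t
  | query : QueryComputable Q 1 fun _ A => Q A
  | mul {a b : ℕ} {f g : T → 𝒜 → unitaryGroup Z ℂ} : QueryComputable Q a f →
      QueryComputable Q b g → QueryComputable Q (a + b) fun t A => f t A * g t A

namespace QueryComputable

variable {Q : 𝒜 → unitaryGroup Z ℂ} {a : ℕ}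

theorem comap {f : T → 𝒜 → unitaryGroup Z ℂ} (h : QueryComputable Q a f) (e : T' → T) :
    QueryComputable Q a fun t => f (e t) := by
  induction h with
  | const g => exact const fun t => g (e t)
  | query => exact query
  | mul _ _ h₁ h₂ => exact mul h₁ h₂

theorem inv (hQ : ∀ A, Q A * Q A = 1) {f : T → 𝒜 → unitaryGroup Z ℂ}
    (h : QueryComputable Q a f) : QueryComputable Q a fun t A => (f t A)⁻¹ := by
  induction h with
  | const g => exact const fun t => (g t)⁻¹
  | query =>
    have : (fun (_ : T) A => (Q A)⁻¹) = fun _ A => Q A := by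
      funext _ A; exact inv_eq_of_mul_eq_one_left (hQ A)
    rw [this]
    exact query
  | mul _ _ h₁ h₂ =>
    simp only [_root_.mul_inv_rev]
    rw [add_comm]
    exact mul h₂ h₁

/-- The circuit has D slots, and each applies the operator or the identity according to the control.
The number of queries is thus the same for all exponents. -/
theorem pow {K : Type} {f : T → 𝒜 → unitaryGroup Z ℂ}
    (h : QueryComputable Q a fun (s : T × Bool) A => if s.2 then f s.1 A else 1)
    (κ : K → ℕ) (D : ℕ) (hκ : ∀ y : K, κ y ≤ D) :
    QueryComputable Q (D * a) fun (s : T × K) A => f s.1 A ^ κ s.2 := by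
  have key : ∀ D, QueryComputable Q (D * a) fun (s : T × K) A => f s.1 A ^ min (κ s.2) D := by
    intro D
    induction D with
    | zero =>
      simp only [Nat.min_zero, pow_zero, zero_mul]
      exact const fun _ => 1
    | succ D ih =>
      rw [add_mul, one_mul]
      have := mul ih (h.comap fun s : T × K => (s.1, decide (D < κ s.2)))
      convert this using 3 with s A
      by_cases hs : D < κ s.2
      · simp [hs, min_eq_right hs.le, pow_succ]
      · simp [hs, min_eq_left (not_lt.1 hs), min_eq_left ((not_lt.1 hs).trans D.le_succ)]
  have := key D
  simpa only [min_eq_left (hκ _)] using this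

/-- A parameter may be moved into a quantum control register, because queries do not depend on it
and just act as the identity there. -/
theorem ctrl {f : T × Y → 𝒜 → unitaryGroup Z ℂ} (h : QueryComputable Q a f) :
    QueryComputable (fun A => ctrl fun _ : Y => Q A) a
      fun (t : T) A => _root_.ctrl fun y => f (t, y) A := by
  induction h with
  | const g => exact const fun t => _root_.ctrl fun y => g (t, y)
  | query => exact query
  | mul _ _ h₁ h₂ =>
    have := mul h₁ h₂
    simp only [← map_mul] at this
    exact this

theorem phaseEstimation {f : T → 𝒜 → unitaryGroup Z ℂ}
    (h : QueryComputable Q a fun (s : T × Bool) A => if s.2 then f s.1 A else 1)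
    (F C : unitaryGroup Y ℂ) (κ : Y → ℕ) (D : ℕ) (hκ : ∀ y, κ y ≤ D) :
    QueryComputable (fun A => _root_.ctrl fun _ : Y => Q A) (D * a)
      fun t A => phaseEstimation F C κ (f t A) := by
  have h1 := ((h.pow κ D hκ).ctrl (T := T))
  have h2 := mul (mul (const (Q := fun A => _root_.ctrl fun _ : Y => Q A)
    fun _ : T => liftRight F) h1) (const fun _ => liftRight C)
  rwa [zero_add, add_zero] at h2

end QueryComputable

end Computable

/-- This implements the reflection about a prepared state: undo the preparation, reflect about the
initial state, prepare again. -/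
theorem reflGate_conj {X : Type} [Fintype X] [DecidableEq X] (W : unitaryGroup X ℂ) (ψ : X → ℂ)
    (h : ∑ x, ‖ψ x‖ ^ 2 = 1) (h' : ∑ x, ‖((W : Matrix X X ℂ) *ᵥ ψ) x‖ ^ 2 = 1) :
    W * reflGate ψ h * W⁻¹ = reflGate ((W : Matrix X X ℂ) *ᵥ ψ) h' := by
  apply ext_mulVec
  intro φ
  obtain ⟨χ, rfl⟩ : ∃ χ, φ = (W : Matrix X X ℂ) *ᵥ χ :=
    ⟨((W⁻¹ : unitaryGroup X ℂ) : Matrix X X ℂ) *ᵥ φ, by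
      rw [← coe_mul_mulVec, mul_inv_cancel]; simp⟩
  rw [← coe_mul_mulVec, inv_mul_cancel_right, coe_mul_mulVec, reflGate_mulVec, reflGate_mulVec]
  have : star ((W : Matrix X X ℂ) *ᵥ ψ) ⬝ᵥ ((W : Matrix X X ℂ) *ᵥ χ) = star ψ ⬝ᵥ χ := by
    rw [star_mulVec, dotProduct_mulVec, vecMul_vecMul, ← star_eq_conjTranspose,
      UnitaryGroup.star_mul_self, vecMul_one]
  rw [this]
  have e : (fun x => 2 * star ψ ⬝ᵥ χ * ψ x - χ x) = (2 * star ψ ⬝ᵥ χ) • ψ - χ := rfl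
  rw [e, mulVec_sub, mulVec_smul]
  rfl

/-! ### The two nested Grover operators and their circuits. -/

section NestedSearch

variable {𝒜 Y Y' Z : Type} [Fintype Y] [DecidableEq Y] [Fintype Y'] [DecidableEq Y']
  [Fintype Z] [DecidableEq Z]

/-- Exchange the two outer registers. -/
def swapPerm (Y Z : Type) : Equiv.Perm ((Z × Y) × Z) where
  toFun a := ((a.2, a.1.2), a.1.1)
  invFun a := ((a.2, a.1.2), a.1.1)
  left_inv _ := rfl
  right_inv _ := rfl

/-- The Grover operator on the index register for the entries with the value given by `v`. -/
def innerGrover (q : 𝒜 → Equiv.Perm Z) (u : Z → ℂ) (hu : ∑ z, ‖u z‖ ^ 2 = 1)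
    (same : Z → Z → Bool) (v : Z) (A : 𝒜) : unitaryGroup Z ℂ :=
  reflGate u hu * signGate fun z => same (q A z) v

theorem innerGrover_computable (q : 𝒜 → Equiv.Perm Z) (hq : ∀ A, q A * q A = 1) (u : Z → ℂ)
    (hu : ∑ z, ‖u z‖ ^ 2 = 1) (same : Z → Z → Bool) :
    QueryComputable (fun A => permGate (q A)) 2 fun (s : Z × Bool) A =>
      if s.2 then innerGrover q u hu same s.1 A else 1 := by
  have h := QueryComputable.mul
    (QueryComputable.const (Q := fun A => permGate (q A))
      fun s : Z × Bool => if s.2 then reflGate u hu else 1)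
    ((QueryComputable.query.mul (QueryComputable.const fun s : Z × Bool =>
      if s.2 then signGate (fun z => same z s.1) else 1)).mul QueryComputable.query)
  convert h using 3 with s A
  rcases s with ⟨v, b⟩
  cases b
  -- With the control off, the gate between the two queries is the identity and the queries cancel.
  · simp only [Bool.false_eq_true, if_false, mul_one, one_mul]
    exact (permGate_mul_self _ (hq A)).symm
  · simp only [if_true, innerGrover]
    rw [permGate_mul_signGate_mul _ _ (hq A)]
    rfl

/-- From the base state (through `P`): superpose the entries, and estimate the frequency of the
value of each. -/
def entryEstimation (q : 𝒜 → Equiv.Perm Z) (u : Z → ℂ) (hu : ∑ z, ‖u z‖ ^ 2 = 1)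
    (same : Z → Z → Bool) (F C : unitaryGroup Y ℂ) (κ : Y → ℕ)
    (P : unitaryGroup ((Z × Y) × Z) ℂ) (A : 𝒜) : unitaryGroup ((Z × Y) × Z) ℂ :=
  ctrl (fun v => phaseEstimation F C κ (innerGrover q u hu same v A)) *
    (permGate (swapPerm Y Z) * (ctrl fun _ => ctrl fun _ => permGate (q A)) *
      permGate (swapPerm Y Z) * P)

theorem entryEstimation_computable {T : Type} (q : 𝒜 → Equiv.Perm Z)
    (hq : ∀ A, q A * q A = 1) (u : Z → ℂ) (hu : ∑ z, ‖u z‖ ^ 2 = 1) (same : Z → Z → Bool)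
    (F C : unitaryGroup Y ℂ) (κ : Y → ℕ) (P : unitaryGroup ((Z × Y) × Z) ℂ) (D : ℕ)
    (hκ : ∀ y, κ y ≤ D) :
    QueryComputable (fun A => ctrl fun _ => ctrl fun _ => permGate (q A)) (D * 2 + 1)
      fun (_ : T) A => entryEstimation q u hu same F C κ P A := by
  have h1 := (((innerGrover_computable q hq u hu same).phaseEstimation F C κ D hκ).comap
    (fun s : T × Z => s.2)).ctrl (T := T)
  have h2 := h1.mul (((QueryComputable.const fun _ => permGate (swapPerm Y Z)).mul
    QueryComputable.query).mul (QueryComputable.const fun _ => permGate (swapPerm Y Z)) |>.mul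
      (QueryComputable.const fun _ => P))
  exact h2

/-- The last register holds the superposition of the queried entries and is only a control from then
on. So the state splits over its contents v into independent runs of phase estimation. The query
reaches that register by swapping it with the first one, where the circuit's query acts. -/
theorem entryEstimation_mulVec (q : 𝒜 → Equiv.Perm Z) (hq : ∀ A, q A * q A = 1) (u : Z → ℂ)
    (hu : ∑ z, ‖u z‖ ^ 2 = 1) (same : Z → Z → Bool) (F C : unitaryGroup Y ℂ) (κ : Y → ℕ)
    (P : unitaryGroup ((Z × Y) × Z) ℂ) (A : 𝒜) (x₀ : (Z × Y) × Z) (y₀ : Y)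
    (hP : (P : Matrix ((Z × Y) × Z) ((Z × Y) × Z) ℂ) *ᵥ basisState x₀
      = fun a => u a.1.1 * basisState y₀ a.1.2 * u a.2) (a : Z × Y) (v : Z) :
    ((entryEstimation q u hu same F C κ P A : Matrix ((Z × Y) × Z) ((Z × Y) × Z) ℂ) *ᵥ
        basisState x₀) (a, v)
      = u (q A v) *
        ((phaseEstimation F C κ (innerGrover q u hu same v A) : Matrix (Z × Y) (Z × Y) ℂ) *ᵥ
          fun a => u a.1 * basisState y₀ a.2) a := by
  have hs : (q A).symm = q A := by
    rw [← Equiv.Perm.inv_def]; exact inv_eq_of_mul_eq_one_left (hq A)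
  rw [entryEstimation, coe_mul_mulVec, ctrl_mulVec]
  have h : ∀ b : Z × Y, (((permGate (swapPerm Y Z) * (ctrl fun _ => ctrl fun _ => permGate (q A)) *
      permGate (swapPerm Y Z) * P : unitaryGroup ((Z × Y) × Z) ℂ) :
        Matrix ((Z × Y) × Z) ((Z × Y) × Z) ℂ) *ᵥ basisState x₀) (b, v)
      = u (q A v) * (u b.1 * basisState y₀ b.2) := by
    rintro ⟨z, y⟩
    rw [coe_mul_mulVec, hP, coe_mul_mulVec, coe_mul_mulVec, permGate_mulVec]
    change (_ *ᵥ _) ((v, y), z) = _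
    rw [ctrl_mulVec, ctrl_mulVec, permGate_mulVec, hs, permGate_mulVec]
    change u z * basisState y₀ y * u (q A v) = _
    ring
  rw [funext h]
  exact congrFun (mulVec_smul (phaseEstimation F C κ (innerGrover q u hu same v A) :
    Matrix (Z × Y) (Z × Y) ℂ) (u (q A v)) _) a

/-- The Grover operator that searches for an entry whose estimated frequency is accepted. -/
def outerGrover (q : 𝒜 → Equiv.Perm Z) (u : Z → ℂ) (hu : ∑ z, ‖u z‖ ^ 2 = 1)
    (same : Z → Z → Bool) (F C : unitaryGroup Y ℂ) (κ : Y → ℕ)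
    (P : unitaryGroup ((Z × Y) × Z) ℂ) (x₀ : (Z × Y) × Z) (acc : Y → Bool) (A : 𝒜) :
    unitaryGroup ((Z × Y) × Z) ℂ :=
  reflGate ((entryEstimation q u hu same F C κ P A : Matrix ((Z × Y) × Z) ((Z × Y) × Z) ℂ) *ᵥ
    basisState x₀) ((sum_norm_sq_mulVec _ _).trans (sum_norm_sq_basisState x₀)) *
    signGate fun a => acc a.1.2

theorem outerGrover_computable {T : Type} (q : 𝒜 → Equiv.Perm Z)
    (hq : ∀ A, q A * q A = 1) (u : Z → ℂ) (hu : ∑ z, ‖u z‖ ^ 2 = 1) (same : Z → Z → Bool)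
    (F C : unitaryGroup Y ℂ) (κ : Y → ℕ) (P : unitaryGroup ((Z × Y) × Z) ℂ) (D : ℕ)
    (hκ : ∀ y, κ y ≤ D) (x₀ : (Z × Y) × Z) (acc : T → Y → Bool) :
    QueryComputable (fun A => ctrl fun _ => ctrl fun _ => permGate (q A)) (2 * (D * 2 + 1))
      fun (s : T × Bool) A =>
        if s.2 then outerGrover q u hu same F C κ P x₀ (acc s.1) A else 1 := by
  have hQ : ∀ A, (ctrl fun _ : Z => ctrl fun _ : Y => permGate (q A)) *
      (ctrl fun _ : Z => ctrl fun _ : Y => permGate (q A)) = 1 := by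
    intro A
    have h2 : (ctrl fun _ : Y => permGate (q A)) * (ctrl fun _ : Y => permGate (q A)) = 1 := by
      rw [← map_mul]
      refine Eq.trans (congrArg ctrl (funext fun _ => ?_)) (map_one ctrl)
      exact permGate_mul_self _ (hq A)
    rw [← map_mul]
    refine Eq.trans (congrArg ctrl (funext fun _ => ?_)) (map_one ctrl)
    exact h2
  -- The preparation W is used once forwards and once backwards, whence the factor 2. With the
  -- control off, W and its inverse cancel, so W itself needs no control.
  have hW := entryEstimation_computable (T := T × Bool) q hq u hu same F C κ P D hκ
  have h := ((hW.mul (QueryComputable.const fun s =>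
    if s.2 then reflGate (basisState x₀) (sum_norm_sq_basisState x₀) else 1)).mul
    (hW.inv hQ)).mul (QueryComputable.const fun s =>
      if s.2 then signGate fun a => acc s.1 a.1.2 else 1)
  rw [add_zero, add_zero] at h
  rw [two_mul]
  convert h using 1
  funext ⟨t, b⟩ A
  cases b
  · simp
  · simp only [if_true, outerGrover]
    rw [reflGate_conj]

end NestedSearch

/-! ### Acceptance probabilities of the inner estimation and of the threshold test. -/

section Acceptance

variable {𝒜 Y Y' Z : Type} [Fintype Y] [DecidableEq Y] [Fintype Y'] [DecidableEq Y']
  [Fintype Z] [DecidableEq Z]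

/-- The estimate that belongs to `y` is at least `θ`. -/
noncomputable def acceptEstimate (κ : Y → ℕ) (D : ℕ) (θ : ℝ) (y : Y) : Bool :=
  decide (θ ≤ Real.sin (phaseAngle D (κ y)) ^ 2)

/-- The square root of the estimate that belongs to `y` is at least `s`. -/
noncomputable def acceptFound (κ : Y → ℕ) (D : ℕ) (s : ℝ) (y : Y) : Bool :=
  decide (s ≤ |Real.sin (phaseAngle D (κ y))|)

theorem abs_sq_sub_le {s ν : ℝ} (hs : 0 ≤ s) (hs1 : s ≤ 1) (hν : 0 ≤ ν) (hν1 : ν ≤ 1) :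
    |s ^ 2 - ν| ≤ 2 * |s - √ν| := by
  have h1 := Real.sqrt_nonneg ν
  have h2 : √ν ≤ 1 := Real.sqrt_le_one.2 hν1
  have h3 : s ^ 2 - ν = (s + √ν) * (s - √ν) := by
    have := Real.sq_sqrt hν
    nlinarith
  rw [h3, abs_mul, abs_of_nonneg (by linarith)]
  exact mul_le_mul_of_nonneg_right (by linarith) (abs_nonneg _)

variable (q : 𝒜 → Equiv.Perm Z) (u : Z → ℂ) (same : Z → Z → Bool)

/-- The weight in `u` of the indices whose entry has the value given by `v`. -/
noncomputable def valueWeight (A : 𝒜) (v : Z) : ℝ := ∑ z with same (q A z) v, ‖u z‖ ^ 2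

/-- `Φ` is the largest weight of a value, and the states with that value have at least this
weight. -/
structure IsModalWeight (A : 𝒜) (Φ : ℝ) : Prop where
  le : ∀ v, u (q A v) ≠ 0 → valueWeight q u same A v ≤ Φ
  ge : Φ ≤ ∑ v with valueWeight q u same A v = Φ, ‖u (q A v)‖ ^ 2

variable {q u same}

theorem valueWeight_nonneg (A : 𝒜) (v : Z) : 0 ≤ valueWeight q u same A v :=
  Finset.sum_nonneg fun _ _ => by positivity

theorem valueWeight_le_one (hu : ∑ z, ‖u z‖ ^ 2 = 1) (A : 𝒜) (v : Z) :
    valueWeight q u same A v ≤ 1 := by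
  rw [valueWeight, ← hu]
  exact Finset.sum_le_sum_of_subset_of_nonneg (Finset.subset_univ _) fun _ _ _ => by positivity

/-- Phase estimation resolves square roots of weights. Passing from weights to square roots loses at
most a factor 2, so a gap Δ with MΔ ≥ 4 is visible. -/
theorem gap_of_le_abs {M : ℕ} {s ν Δ : ℝ} (hs : 0 ≤ s) (hs1 : s ≤ 1) (hν : 0 ≤ ν) (hν1 : ν ≤ 1)
    (hM : 4 ≤ M * Δ) (h : Δ ≤ |s ^ 2 - ν|) : 2 ≤ M * |s - √ν| := by
  have h1 := abs_sq_sub_le hs hs1 hν hν1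
  nlinarith [mul_le_mul_of_nonneg_left (h.trans h1) (Nat.cast_nonneg (α := ℝ) M)]

theorem inner_reject_le (hu : ∑ z, ‖u z‖ ^ 2 = 1) {κ : Y → ℕ} {F C : unitaryGroup Y ℂ} {y₀ : Y}
    {D M r : ℕ} (hE : IsPhaseEstimator κ F C y₀ D M r) {θ Δ : ℝ} (hM : 4 ≤ M * Δ) (A : 𝒜) (v : Z)
    (h : θ + Δ ≤ valueWeight q u same A v) :
    ∑ a : Z × Y with !acceptEstimate κ D θ a.2,
      ‖((phaseEstimation F C κ (innerGrover q u hu same v A) : Matrix (Z × Y) (Z × Y) ℂ) *ᵥ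
        fun a => u a.1 * basisState y₀ a.2) a‖ ^ 2 ≤ Fintype.card Y * (1 / 4) ^ r := by
  refine phaseEstimation_bad_le hE u hu _ (fun y => !acceptEstimate κ D θ y) fun y hy => ?_
  refine gap_of_le_abs (abs_nonneg _) (Real.abs_sin_le_one _) (valueWeight_nonneg A v)
    (valueWeight_le_one hu A v) hM ?_
  simp only [acceptEstimate, Bool.not_eq_true', decide_eq_false_iff_not, not_le] at hy
  rw [valueWeight] at h
  rw [sq_abs, abs_sub_comm]
  exact le_trans (by linarith) (le_abs_self _)

theorem inner_accept_le (hu : ∑ z, ‖u z‖ ^ 2 = 1) {κ : Y → ℕ} {F C : unitaryGroup Y ℂ} {y₀ : Y}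
    {D M r : ℕ} (hE : IsPhaseEstimator κ F C y₀ D M r) {θ Δ : ℝ} (hM : 4 ≤ M * Δ) (A : 𝒜) (v : Z)
    (h : valueWeight q u same A v ≤ θ - Δ) :
    ∑ a : Z × Y with acceptEstimate κ D θ a.2,
      ‖((phaseEstimation F C κ (innerGrover q u hu same v A) : Matrix (Z × Y) (Z × Y) ℂ) *ᵥ
        fun a => u a.1 * basisState y₀ a.2) a‖ ^ 2 ≤ Fintype.card Y * (1 / 4) ^ r := by
  refine phaseEstimation_bad_le hE u hu _ (acceptEstimate κ D θ) fun y hy => ?_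
  refine gap_of_le_abs (abs_nonneg _) (Real.abs_sin_le_one _) (valueWeight_nonneg A v)
    (valueWeight_le_one hu A v) hM ?_
  simp only [acceptEstimate, decide_eq_true_eq] at hy
  rw [valueWeight] at h
  rw [sq_abs]
  exact le_trans (by linarith) (le_abs_self _)

theorem sum_norm_sq_mul_basisState (hu : ∑ z, ‖u z‖ ^ 2 = 1) (y₀ : Y) :
    ∑ a : Z × Y, ‖u a.1 * basisState y₀ a.2‖ ^ 2 = 1 := by
  simp only [norm_mul, mul_pow]
  rw [Fintype.sum_prod_type]
  simp only [← Finset.mul_sum, sum_norm_sq_basisState, mul_one, hu]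

variable {κ : Y → ℕ} {F C : unitaryGroup Y ℂ} {y₀ : Y} {D M r : ℕ}
  {P : unitaryGroup ((Z × Y) × Z) ℂ} {x₀ : (Z × Y) × Z}

theorem sum_entryEstimation (hq : ∀ A, q A * q A = 1) (hu : ∑ z, ‖u z‖ ^ 2 = 1)
    (hP : (P : Matrix ((Z × Y) × Z) ((Z × Y) × Z) ℂ) *ᵥ basisState x₀
      = fun a => u a.1.1 * basisState y₀ a.1.2 * u a.2) (acc : Y → Bool) (A : 𝒜) :
    ∑ a : (Z × Y) × Z with acc a.1.2, ‖((entryEstimation q u hu same F C κ P A :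
        Matrix ((Z × Y) × Z) ((Z × Y) × Z) ℂ) *ᵥ basisState x₀) a‖ ^ 2
      = ∑ v, ‖u (q A v)‖ ^ 2 * ∑ a : Z × Y with acc a.2,
        ‖((phaseEstimation F C κ (innerGrover q u hu same v A) : Matrix (Z × Y) (Z × Y) ℂ) *ᵥ
          fun a => u a.1 * basisState y₀ a.2) a‖ ^ 2 := by
  rw [Finset.sum_filter, Fintype.sum_prod_type_right]
  refine Finset.sum_congr rfl fun v _ => ?_
  rw [Finset.sum_filter, Finset.mul_sum]
  refine Finset.sum_congr rfl fun a _ => ?_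
  rw [entryEstimation_mulVec q hq u hu same F C κ P A x₀ y₀ hP, norm_mul, mul_pow]
  split_ifs <;> simp

theorem entryEstimation_accept_le (hq : ∀ A, q A * q A = 1) (hu : ∑ z, ‖u z‖ ^ 2 = 1)
    (hE : IsPhaseEstimator κ F C y₀ D M r)
    (hP : (P : Matrix ((Z × Y) × Z) ((Z × Y) × Z) ℂ) *ᵥ basisState x₀
      = fun a => u a.1.1 * basisState y₀ a.1.2 * u a.2) {A : 𝒜} {Φ : ℝ}
    (hΦ : IsModalWeight q u same A Φ) {θ Δ : ℝ} (hM : 4 ≤ M * Δ) (h : Φ ≤ θ - Δ) :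
    ∑ a : (Z × Y) × Z with acceptEstimate κ D θ a.1.2,
      ‖((entryEstimation q u hu same F C κ P A :
        Matrix ((Z × Y) × Z) ((Z × Y) × Z) ℂ) *ᵥ basisState x₀) a‖ ^ 2
      ≤ Fintype.card Y * (1 / 4) ^ r := by
  rw [sum_entryEstimation hq hu hP]
  calc _ ≤ ∑ v, ‖u (q A v)‖ ^ 2 * (Fintype.card Y * (1 / 4) ^ r) := by
        refine Finset.sum_le_sum fun v _ => ?_
        by_cases hv : u (q A v) = 0
        · simp [hv]
        · exact mul_le_mul_of_nonneg_left
            (inner_accept_le hu hE hM A v ((hΦ.le v hv).trans h)) (by positivity)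
    _ = _ := by
        rw [← Finset.sum_mul, Equiv.sum_comp (q A) fun z => ‖u z‖ ^ 2, hu, one_mul]

/-- Only the states whose value has weight exactly Φ are counted. They carry total weight at least
Φ, and each is accepted with probability at least 1/2. -/
theorem le_entryEstimation_accept (hq : ∀ A, q A * q A = 1) (hu : ∑ z, ‖u z‖ ^ 2 = 1)
    (hE : IsPhaseEstimator κ F C y₀ D M r)
    (hP : (P : Matrix ((Z × Y) × Z) ((Z × Y) × Z) ℂ) *ᵥ basisState x₀
      = fun a => u a.1.1 * basisState y₀ a.1.2 * u a.2) {A : 𝒜} {Φ : ℝ}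
    (hΦ : IsModalWeight q u same A Φ) {θ Δ : ℝ} (hM : 4 ≤ M * Δ) (h : θ + Δ ≤ Φ)
    (hr : (Fintype.card Y : ℝ) * (1 / 4) ^ r ≤ 1 / 2) :
    Φ / 2 ≤ ∑ a : (Z × Y) × Z with acceptEstimate κ D θ a.1.2,
      ‖((entryEstimation q u hu same F C κ P A :
        Matrix ((Z × Y) × Z) ((Z × Y) × Z) ℂ) *ᵥ basisState x₀) a‖ ^ 2 := by
  rw [sum_entryEstimation hq hu hP]
  calc Φ / 2 ≤ ∑ v with valueWeight q u same A v = Φ, ‖u (q A v)‖ ^ 2 * (1 / 2) := by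
        rw [← Finset.sum_mul]
        linarith [hΦ.ge]
    _ ≤ ∑ v with valueWeight q u same A v = Φ, ‖u (q A v)‖ ^ 2 *
        ∑ a : Z × Y with acceptEstimate κ D θ a.2,
        ‖((phaseEstimation F C κ (innerGrover q u hu same v A) : Matrix (Z × Y) (Z × Y) ℂ) *ᵥ
          fun a => u a.1 * basisState y₀ a.2) a‖ ^ 2 := by
        refine Finset.sum_le_sum fun v hv => mul_le_mul_of_nonneg_left ?_ (by positivity)
        have h1 := inner_reject_le hu hE hM A v (h.trans (Finset.mem_filter.1 hv).2.ge)
        have h2 := Finset.sum_filter_add_sum_filter_not Finset.univ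
          (fun a : Z × Y => acceptEstimate κ D θ a.2 = true) fun a =>
          ‖((phaseEstimation F C κ (innerGrover q u hu same v A) : Matrix (Z × Y) (Z × Y) ℂ) *ᵥ
            fun a => u a.1 * basisState y₀ a.2) a‖ ^ 2
        rw [sum_norm_sq_mulVec, sum_norm_sq_mul_basisState hu] at h2
        simp only [Bool.not_eq_true', Bool.not_eq_true] at h1 h2
        linarith
    _ ≤ _ := Finset.sum_le_sum_of_subset_of_nonneg (Finset.subset_univ _)
        fun _ _ _ => mul_nonneg (by positivity) (Finset.sum_nonneg fun _ _ => by positivity)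

/-- Search for an entry whose estimated frequency is at least `θ`. -/
noncomputable def thresholdTest (q : 𝒜 → Equiv.Perm Z) (u : Z → ℂ) (hu : ∑ z, ‖u z‖ ^ 2 = 1)
    (same : Z → Z → Bool) (F C : unitaryGroup Y ℂ) (κ : Y → ℕ) (D : ℕ)
    (P : unitaryGroup ((Z × Y) × Z) ℂ) (x₀ : (Z × Y) × Z) (F' C' : unitaryGroup Y' ℂ)
    (κ' : Y' → ℕ) (θ : ℝ) (A : 𝒜) : unitaryGroup (((Z × Y) × Z) × Y') ℂ :=
  phaseEstimation F' C' κ' (outerGrover q u hu same F C κ P x₀ (acceptEstimate κ D θ) A) *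
    ctrl fun _ => entryEstimation q u hu same F C κ P A

theorem thresholdTest_computable {T : Type} [Fintype T] [DecidableEq T]
    (hq : ∀ A, q A * q A = 1) (hu : ∑ z, ‖u z‖ ^ 2 = 1) (hκ : ∀ y, κ y ≤ D)
    (F' C' : unitaryGroup Y' ℂ) (κ' : Y' → ℕ) {D' : ℕ} (hκ' : ∀ y, κ' y ≤ D') (θ : T → ℝ) :
    QueryComputable (fun A => ctrl fun _ => ctrl fun _ => ctrl fun _ => permGate (q A))
      (D' * (2 * (D * 2 + 1)) + (D * 2 + 1)) fun t A =>
        thresholdTest q u hu same F C κ D P x₀ F' C' κ' (θ t) A := by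
  have h1 := QueryComputable.phaseEstimation
    (f := fun t A => outerGrover q u hu same F C κ P x₀ (acceptEstimate κ D (θ t)) A)
    (outerGrover_computable q hq u hu same F C κ P D hκ x₀ fun t => acceptEstimate κ D (θ t))
    F' C' κ' D' hκ'
  have h2 := (entryEstimation_computable (T := T × Y') q hq u hu same F C κ P D hκ).ctrl
  exact h1.mul h2

variable {F' C' : unitaryGroup Y' ℂ} {κ' : Y' → ℕ} {y₀' : Y'} {D' M' r' : ℕ}

theorem thresholdTest_mulVec (hu : ∑ z, ‖u z‖ ^ 2 = 1) (θ : ℝ) (A : 𝒜) :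
    (thresholdTest q u hu same F C κ D P x₀ F' C' κ' θ A :
        Matrix (((Z × Y) × Z) × Y') (((Z × Y) × Z) × Y') ℂ) *ᵥ basisState (x₀, y₀')
      = (phaseEstimation F' C' κ'
          (outerGrover q u hu same F C κ P x₀ (acceptEstimate κ D θ) A) :
          Matrix (((Z × Y) × Z) × Y') (((Z × Y) × Z) × Y') ℂ) *ᵥ
          fun a => ((entryEstimation q u hu same F C κ P A :
            Matrix ((Z × Y) × Z) ((Z × Y) × Z) ℂ) *ᵥ basisState x₀) a.1 * basisState y₀' a.2 := by
  rw [thresholdTest, coe_mul_mulVec]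
  congr 1
  ext ⟨a, y⟩
  rw [ctrl_mulVec]
  have : (fun z' => basisState (x₀, y₀') (z', y)) = (basisState y₀' y : ℂ) • basisState x₀ := by
    ext z
    simp only [basisState, Pi.single_apply, Prod.mk.injEq, Pi.smul_apply, smul_eq_mul]
    split_ifs <;> simp_all
  rw [this, mulVec_smul, Pi.smul_apply, smul_eq_mul, mul_comm]

theorem thresholdTest_reject_le (hq : ∀ A, q A * q A = 1) (hu : ∑ z, ‖u z‖ ^ 2 = 1)
    (hE : IsPhaseEstimator κ F C y₀ D M r) (hE' : IsPhaseEstimator κ' F' C' y₀' D' M' r')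
    (hP : (P : Matrix ((Z × Y) × Z) ((Z × Y) × Z) ℂ) *ᵥ basisState x₀
      = fun a => u a.1.1 * basisState y₀ a.1.2 * u a.2) {A : 𝒜} {Φ : ℝ}
    (hΦ : IsModalWeight q u same A Φ) {θ Δ s : ℝ} (hM : 4 ≤ M * Δ) (hM' : 4 ≤ M' * s)
    (h : θ + Δ ≤ Φ) (hsΦ : 8 * s ^ 2 ≤ Φ)
    (hr : (Fintype.card Y : ℝ) * (1 / 4) ^ r ≤ 1 / 2) :
    ∑ a : ((Z × Y) × Z) × Y' with !acceptFound κ' D' s a.2,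
      ‖((thresholdTest q u hu same F C κ D P x₀ F' C' κ' θ A :
        Matrix (((Z × Y) × Z) × Y') (((Z × Y) × Z) × Y') ℂ) *ᵥ basisState (x₀, y₀')) a‖ ^ 2
      ≤ Fintype.card Y' * (1 / 4) ^ r' := by
  rw [thresholdTest_mulVec]
  refine phaseEstimation_bad_le hE' _ _ _ (fun y => !acceptFound κ' D' s y) fun y hy => ?_
  have h1 := le_entryEstimation_accept hq hu hE hP hΦ hM h hr
  -- The accepted weight is at least Φ/2 ≥ (2s)², so an estimate below s is off by more than s.
  have h2 := Real.le_sqrt_of_sq_le (x := 2 * s) (le_trans (by linarith) h1)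
  simp only [acceptFound, Bool.not_eq_true', decide_eq_false_iff_not, not_le] at hy
  rw [abs_sub_comm]
  have h3 := (le_abs_self (√_ - |Real.sin (phaseAngle D' (κ' y))|)).trans' (sub_le_sub h2 hy.le)
  nlinarith [mul_le_mul_of_nonneg_left h3 (Nat.cast_nonneg (α := ℝ) M')]

theorem thresholdTest_accept_le (hq : ∀ A, q A * q A = 1) (hu : ∑ z, ‖u z‖ ^ 2 = 1)
    (hE : IsPhaseEstimator κ F C y₀ D M r) (hE' : IsPhaseEstimator κ' F' C' y₀' D' M' r')
    (hP : (P : Matrix ((Z × Y) × Z) ((Z × Y) × Z) ℂ) *ᵥ basisState x₀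
      = fun a => u a.1.1 * basisState y₀ a.1.2 * u a.2) {A : 𝒜} {Φ : ℝ}
    (hΦ : IsModalWeight q u same A Φ) {θ Δ s : ℝ} (hM : 4 ≤ M * Δ) (hM' : 4 ≤ M' * s)
    (h : Φ ≤ θ - Δ) (hs : 0 ≤ s) (hr : (Fintype.card Y : ℝ) * (1 / 4) ^ r ≤ s ^ 2 / 4) :
    ∑ a : ((Z × Y) × Z) × Y' with acceptFound κ' D' s a.2,
      ‖((thresholdTest q u hu same F C κ D P x₀ F' C' κ' θ A :
        Matrix (((Z × Y) × Z) × Y') (((Z × Y) × Z) × Y') ℂ) *ᵥ basisState (x₀, y₀')) a‖ ^ 2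
      ≤ Fintype.card Y' * (1 / 4) ^ r' := by
  rw [thresholdTest_mulVec]
  refine phaseEstimation_bad_le hE' _ _ _ (fun y => acceptFound κ' D' s y) fun y hy => ?_
  have h1 := entryEstimation_accept_le hq hu hE hP hΦ hM h
  -- The falsely accepted amplitude is at most s/2, so an estimate of at least s is off by s/2,
  -- which is 2/M' or more.
  have h2 := Real.sqrt_le_iff.2 ⟨by linarith, (h1.trans hr).trans (by linarith : _ ≤ (s / 2) ^ 2)⟩
  simp only [acceptFound, decide_eq_true_eq] at hy
  have h3 := (le_abs_self (|Real.sin (phaseAngle D' (κ' y))| - √_)).trans' (sub_le_sub hy h2)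
  nlinarith [mul_le_mul_of_nonneg_left h3 (Nat.cast_nonneg (α := ℝ) M')]

end Acceptance

/-! ### From circuits to steps on density matrices, and rounds that end in a full measurement. -/

section DensityMatrices

variable {n m w : ℕ}

/-- The effect of a list of steps on a density matrix. -/
noncomputable def runSteps (A : Fin n → Fin m) (l : List (QStep n m w))
    (ρ : Matrix (Bits w) (Bits w) ℂ) : Matrix (Bits w) (Bits w) ℂ :=
  l.foldl (QStep.apply A) ρ

theorem runSteps_append (A : Fin n → Fin m) (l l' : List (QStep n m w))
    (ρ : Matrix (Bits w) (Bits w) ℂ) :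
    runSteps A (l ++ l') ρ = runSteps A l' (runSteps A l ρ) :=
  List.foldl_append

theorem runSteps_cons (A : Fin n → Fin m) (s : QStep n m w) (l : List (QStep n m w))
    (ρ : Matrix (Bits w) (Bits w) ℂ) :
    runSteps A (s :: l) ρ = runSteps A l (s.apply A ρ) := rfl

/-- A unitary in other coordinates. -/
def transportGate {X X' : Type} [Fintype X] [DecidableEq X] [Fintype X'] [DecidableEq X']
    (φ : X ≃ X') : unitaryGroup X ℂ →* unitaryGroup X' ℂ where
  toFun U := ⟨(U : Matrix X X ℂ).submatrix φ.symm φ.symm, by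
    rw [mem_unitaryGroup_iff, star_eq_conjTranspose, conjTranspose_submatrix,
      submatrix_mul_equiv, ← star_eq_conjTranspose, mem_unitaryGroup_iff.1 U.2]
    simp⟩
  map_one' := Subtype.ext (by simp)
  map_mul' U V := Subtype.ext (by
    simp only [UnitaryGroup.mul_val, MulMemClass.mk_mul_mk]
    rw [submatrix_mul_equiv])

theorem QueryComputable.exists_steps {X : Type} [Fintype X] [DecidableEq X]
    (φ : X ≃ Bits w) (e : Fin (Nat.clog 2 n) ⊕ Fin (Nat.clog 2 m) ↪ Fin w)
    (σ : (Fin n → Fin m) → Equiv.Perm X)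
    (hσ : ∀ A x, φ (σ A x) = oracleMap e A (φ x)) {a : ℕ}
    {f : Unit → (Fin n → Fin m) → unitaryGroup X ℂ}
    (h : QueryComputable (fun A => permGate (σ A)) a f) :
    ∃ l : List (QStep n m w), l.countP QStep.isQuery = a ∧ ∀ A ρ, runSteps A l ρ
      = (transportGate φ (f () A) : Matrix (Bits w) (Bits w) ℂ) * ρ *
        (transportGate φ (f () A) : Matrix (Bits w) (Bits w) ℂ)ᴴ := by
  induction h with
  | const g => exact ⟨[.gate (transportGate φ (g ()))], rfl, fun _ _ => rfl⟩
  | query =>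
    refine ⟨[.query e], rfl, fun A ρ => ?_⟩
    have : oracleMatrix e A
        = (transportGate φ (permGate (σ A)) : Matrix (Bits w) (Bits w) ℂ) := by
      ext y x
      simp only [oracleMatrix, of_apply, transportGate, permGate, MonoidHom.coe_mk, OneHom.coe_mk,
        submatrix_apply, Equiv.symm_apply_eq, hσ, Equiv.apply_symm_apply]
    rw [← this]
    rfl
  | mul _ _ h₁ h₂ =>
    obtain ⟨l₁, c₁, r₁⟩ := h₁
    obtain ⟨l₂, c₂, r₂⟩ := h₂
    -- The right factor of a product acts first.
    refine ⟨l₂ ++ l₁, by rw [List.countP_append, c₁, c₂, add_comm], fun A ρ => ?_⟩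
    rw [runSteps_append, r₂, r₁, map_mul, UnitaryGroup.mul_val, conjTranspose_mul]
    simp only [mul_assoc]

theorem runSteps_measure (A : Fin n → Fin m) (l : List (Fin w)) (ρ : Matrix (Bits w) (Bits w) ℂ) :
    runSteps A (l.map .measure) ρ
      = of fun x y => if ∀ j ∈ l, x j = y j then ρ x y else 0 := by
  induction l generalizing ρ with
  | nil => ext x y; simp [runSteps]
  | cons j l ih =>
    rw [List.map_cons, runSteps_cons, ih]
    ext x y
    simp only [QStep.apply, of_apply, List.forall_mem_cons]
    split_ifs <;> tauto

theorem runSteps_measure_all (A : Fin n → Fin m) (ρ : Matrix (Bits w) (Bits w) ℂ) :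
    runSteps A ((List.finRange w).map .measure) ρ = diagonal fun x => ρ x x := by
  rw [runSteps_measure]
  ext x y
  rw [of_apply, diagonal_apply]
  by_cases h : x = y
  · subst h
    simp
  · rw [if_neg h, if_neg fun h' => h (funext fun j => h' j (List.mem_finRange j))]

/-- Set the bits in `l` to `false`. -/
def clearBits (l : List (Fin w)) (x : Bits w) : Bits w := fun j => if j ∈ l then false else x j

theorem apply_reset_diagonal (A : Fin n → Fin m) (j : Fin w) (p : Bits w → ℂ) :
    (QStep.reset j : QStep n m w).apply A (diagonal p)
      = diagonal fun x => ∑ x', if Function.update x' j false = x then p x' else 0 := by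
  ext x y
  simp only [QStep.apply, of_apply, diagonal_apply]
  by_cases hxy : x = y
  · subst hxy
    simp only [and_self, if_true]
    by_cases hx : x j = false
    · rw [if_pos hx, ← Finset.sum_filter]
      refine Finset.sum_nbij (fun b => Function.update x j b) ?_ ?_ ?_ fun _ _ => rfl
      · intro b _
        simp only [Finset.mem_filter, Finset.mem_univ, true_and, Function.update_idem]
        rw [← hx, Function.update_eq_self]
      · intro b _ b' _ h
        simpa using congrFun h j
      · intro x' hx'
        simp only [Finset.coe_filter, Finset.mem_univ, true_and, Set.mem_ofPred_eq] at hx'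
        exact ⟨x' j, by simp, by simp [← hx']⟩
    · rw [if_neg hx, Finset.sum_eq_zero]
      intro x' _
      rw [if_neg]
      rintro rfl
      simp at hx
  · rw [if_neg hxy]
    split_ifs with h
    · refine Finset.sum_eq_zero fun b _ => if_neg fun hb => hxy ?_
      ext i
      by_cases hi : i = j
      · rw [hi, h.1, h.2]
      · simpa [hi] using congrFun hb i
    · rfl

theorem runSteps_reset_diagonal (A : Fin n → Fin m) (l : List (Fin w)) (p : Bits w → ℂ) :
    runSteps A (l.map .reset) (diagonal p)
      = diagonal fun x => ∑ x', if clearBits l x' = x then p x' else 0 := by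
  induction l generalizing p with
  | nil =>
    have : ∀ x : Bits w, clearBits [] x = x := fun x => by ext; simp [clearBits]
    simp [runSteps, this]
  | cons j l ih =>
    rw [List.map_cons, runSteps_cons, apply_reset_diagonal, ih]
    congr 1
    ext x
    simp only [← Finset.sum_filter]
    rw [Finset.sum_sigma']
    refine (Finset.sum_nbij (fun x' => ⟨Function.update x' j false, x'⟩) ?_ ?_ ?_ ?_).symm
    · intro x' hx'
      simp only [Finset.mem_filter, Finset.mem_univ, true_and, Finset.mem_sigma, and_true]
        at hx' ⊢
      rw [← hx']
      ext i
      by_cases hi : i = j <;> simp [clearBits, hi]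
    · intro a _ b _ h
      exact (Sigma.mk.inj h).2.eq
    · rintro ⟨y, x'⟩ h
      simp only [Finset.coe_sigma, Finset.coe_filter, Finset.mem_univ, true_and, Set.mem_sigma_iff,
        Set.mem_ofPred_eq] at h
      refine ⟨x', ?_, by simp [h.2]⟩
      simp only [Finset.coe_filter, Finset.mem_univ, true_and, Set.mem_ofPred_eq]
      rw [← h.1, ← h.2]
      ext i
      by_cases hi : i = j <;> simp [clearBits, hi]
    · intro _ _; rfl

/-- The distribution of the classical state after applying a unitary with transition
probabilities `‖U x' x‖²`, measuring everything, and clearing the bits in `l`. -/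
noncomputable def roundDistribution (U : Matrix (Bits w) (Bits w) ℂ) (l : List (Fin w))
    (p : Bits w → ℝ) (x : Bits w) : ℝ :=
  ∑ x', if clearBits l x' = x then ∑ x'', ‖U x' x''‖ ^ 2 * p x'' else 0

theorem conj_diagonal_apply (U : Matrix (Bits w) (Bits w) ℂ) (p : Bits w → ℝ) (x : Bits w) :
    (U * diagonal (fun x => (p x : ℂ)) * Uᴴ) x x
      = ((∑ x', ‖U x x'‖ ^ 2 * p x' : ℝ) : ℂ) := by
  rw [mul_apply]
  simp only [mul_diagonal, conjTranspose_apply, RCLike.star_def]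
  push_cast
  refine Finset.sum_congr rfl fun x' _ => ?_
  rw [← Complex.mul_conj']
  ring

theorem runSteps_round (A : Fin n → Fin m) (l : List (Fin w)) (c : List (QStep n m w))
    (U : Matrix (Bits w) (Bits w) ℂ) (hc : ∀ ρ, runSteps A c ρ = U * ρ * Uᴴ) (p : Bits w → ℝ) :
    runSteps A (c ++ ((List.finRange w).map .measure ++ l.map .reset))
      (diagonal fun x => (p x : ℂ)) = diagonal fun x => (roundDistribution U l p x : ℂ) := by
  rw [runSteps_append, runSteps_append, hc, runSteps_measure_all, runSteps_reset_diagonal]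
  congr 1
  ext x
  simp only [conj_diagonal_apply, roundDistribution]
  rw [Complex.ofReal_sum]
  refine Finset.sum_congr rfl fun x' _ => ?_
  split_ifs <;> simp

theorem roundDistribution_nonneg (U : Matrix (Bits w) (Bits w) ℂ) (l : List (Fin w))
    {p : Bits w → ℝ} (hp : ∀ x, 0 ≤ p x) (x : Bits w) : 0 ≤ roundDistribution U l p x :=
  Finset.sum_nonneg fun _ _ => by
    split_ifs
    · exact Finset.sum_nonneg fun x'' _ => mul_nonneg (by positivity) (hp x'')
    · exact le_rfl

theorem sum_roundDistribution_mul (U : Matrix (Bits w) (Bits w) ℂ) (l : List (Fin w))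
    (p g : Bits w → ℝ) :
    ∑ x, roundDistribution U l p x * g x
      = ∑ x, p x * ∑ x', ‖U x' x‖ ^ 2 * g (clearBits l x') := by
  simp only [roundDistribution, Finset.sum_mul, ite_mul, zero_mul]
  rw [Finset.sum_comm]
  simp only [Finset.sum_ite_eq, Finset.mem_univ, if_true, Finset.mul_sum]
  rw [Finset.sum_comm]
  refine Finset.sum_congr rfl fun _ _ => Finset.sum_congr rfl fun _ _ => by ring

theorem sum_norm_sq_column (U : unitaryGroup (Bits w) ℂ) (x : Bits w) :
    ∑ x', ‖(U : Matrix (Bits w) (Bits w) ℂ) x' x‖ ^ 2 = 1 := by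
  simp only [← mulVec_basisState]
  rw [sum_norm_sq_mulVec, sum_norm_sq_basisState]

-- After the measurement of all wires the density matrix is diagonal, so the rounds form a Markov
-- chain on bit strings. A good state becomes bad with probability at most η per round, and the J
-- failure probabilities add up. Resetting the wires in `l` allows every round to reuse them.
open Classical in
theorem exists_steps_rounds (a J : ℕ) (V : Fin J → (Fin n → Fin m) → unitaryGroup (Bits w) ℂ)
    (hV : ∀ j, ∃ c : List (QStep n m w), c.countP QStep.isQuery = a ∧ ∀ A ρ, runSteps A c ρ
      = (V j A : Matrix (Bits w) (Bits w) ℂ) * ρ * (V j A : Matrix (Bits w) (Bits w) ℂ)ᴴ)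
    (l : List (Fin w)) (Good : (Fin n → Fin m) → ℕ → Bits w → Prop)
    (h0 : ∀ A, Good A 0 fun _ => false) (η : ℝ)
    (hη : ∀ A, ∀ j : Fin J, ∀ x, Good A j x →
      ∑ x' with ¬ Good A (j + 1) (clearBits l x'),
        ‖(V j A : Matrix (Bits w) (Bits w) ℂ) x' x‖ ^ 2 ≤ η) :
    ∃ c : List (QStep n m w), c.countP QStep.isQuery = J * a ∧ ∀ A, ∃ p : Bits w → ℝ,
      runSteps A c (Matrix.single (fun _ => false) (fun _ => false) 1)
        = diagonal (fun x => (p x : ℂ)) ∧ (∀ x, 0 ≤ p x) ∧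
      1 - J * η ≤ ∑ x with Good A J x, p x := by
  -- The induction carries the total mass 1 and an upper bound for the mass of the bad states.
  suffices h : ∀ j ≤ J, ∃ c : List (QStep n m w), c.countP QStep.isQuery = j * a ∧
      ∀ A, ∃ p : Bits w → ℝ,
      runSteps A c (Matrix.single (fun _ => false) (fun _ => false) 1)
        = diagonal (fun x => (p x : ℂ)) ∧ (∀ x, 0 ≤ p x) ∧ ∑ x, p x = 1 ∧
      ∑ x, p x * (if Good A j x then 0 else 1) ≤ j * η by
    obtain ⟨c, hc, h⟩ := h J le_rfl
    refine ⟨c, hc, fun A => ?_⟩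
    obtain ⟨p, hp, hp0, hp1, hg⟩ := h A
    refine ⟨p, hp, hp0, ?_⟩
    have e : ∑ x, p x = ∑ x with Good A J x, p x + ∑ x, p x * (if Good A J x then 0 else 1) := by
      rw [Finset.sum_filter, ← Finset.sum_add_distrib]
      refine Finset.sum_congr rfl fun x _ => ?_
      split_ifs <;> simp
    linarith
  intro j hj
  induction j with
  | zero =>
    refine ⟨[], by simp, fun A => ⟨Pi.single (fun _ => false) 1, ?_, ?_, ?_, ?_⟩⟩
    · ext x y
      simp only [runSteps, List.foldl_nil, single_apply, diagonal_apply, Pi.single_apply]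
      by_cases hxy : x = y
      · subst hxy
        by_cases hx : x = fun _ => false
        · simp [hx]
        · simp [hx, Ne.symm hx]
      · rw [if_neg hxy, if_neg fun h => hxy (h.1.symm.trans h.2)]
    · intro x
      simp only [Pi.single_apply]
      split_ifs <;> norm_num
    · simp
    · rw [Finset.sum_eq_zero]
      · simp
      · intro x _
        by_cases hx : x = fun _ => false
        · simp [hx, h0 A]
        · simp [hx]
  | succ j ih =>
    obtain ⟨c, hc, h⟩ := ih (by omega)
    obtain ⟨c', hc', h'⟩ := hV ⟨j, hj⟩
    refine ⟨c ++ (c' ++ ((List.finRange w).map .measure ++ l.map .reset)), ?_, fun A => ?_⟩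
    · have e1 : ∀ k : List (Fin w), (k.map (QStep.measure (n := n) (m := m))).countP QStep.isQuery
          = 0 := fun k => by
        rw [List.countP_eq_zero]; simp [QStep.isQuery]
      have e2 : ∀ k : List (Fin w), (k.map (QStep.reset (n := n) (m := m))).countP QStep.isQuery
          = 0 := fun k => by
        rw [List.countP_eq_zero]; simp [QStep.isQuery]
      rw [List.countP_append, List.countP_append, List.countP_append, hc, hc', e1, e2]
      ring
    obtain ⟨p, hp, hp0, hp1, hg⟩ := h A
    refine ⟨roundDistribution (V ⟨j, hj⟩ A) l p, ?_, roundDistribution_nonneg _ _ hp0, ?_, ?_⟩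
    · rw [runSteps_append, hp, runSteps_round A l c' (V ⟨j, hj⟩ A) (h' A)]
    · have := sum_roundDistribution_mul (V ⟨j, hj⟩ A) l p fun _ => 1
      simpa only [mul_one, sum_norm_sq_column, hp1] using this
    · rw [sum_roundDistribution_mul (V ⟨j, hj⟩ A) l p fun x => if Good A (j + 1) x then 0 else 1]
      have hbound : ∀ x, p x * ∑ x', ‖(V ⟨j, hj⟩ A : Matrix (Bits w) (Bits w) ℂ) x' x‖ ^ 2 *
          (if Good A (j + 1) (clearBits l x') then 0 else 1)
          ≤ p x * (if Good A j x then 0 else 1) + p x * η := by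
        intro x
        rw [← mul_add]
        refine mul_le_mul_of_nonneg_left ?_ (hp0 x)
        have e : ∑ x', ‖(V ⟨j, hj⟩ A : Matrix (Bits w) (Bits w) ℂ) x' x‖ ^ 2 *
            (if Good A (j + 1) (clearBits l x') then 0 else 1)
            = ∑ x' with ¬ Good A (j + 1) (clearBits l x'),
              ‖(V ⟨j, hj⟩ A : Matrix (Bits w) (Bits w) ℂ) x' x‖ ^ 2 := by
          rw [Finset.sum_filter]
          refine Finset.sum_congr rfl fun x' _ => ?_
          by_cases hx : Good A (j + 1) (clearBits l x') <;> simp [hx]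
        rw [e]
        have hη0 : 0 ≤ η := (hη A ⟨0, by omega⟩ _ (h0 A)).trans'
          (Finset.sum_nonneg fun _ _ => by positivity)
        split_ifs with hx
        · rw [zero_add]
          exact hη A ⟨j, hj⟩ x hx
        · refine le_trans ?_ (le_add_of_nonneg_right hη0)
          rw [← sum_norm_sq_column (V ⟨j, hj⟩ A) x]
          exact Finset.sum_le_sum_of_subset_of_nonneg (Finset.subset_univ _)
            fun _ _ _ => by positivity
      refine (Finset.sum_le_sum fun x _ => hbound x).trans ?_
      rw [Finset.sum_add_distrib, ← Finset.sum_mul, hp1]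
      push_cast
      linarith

end DensityMatrices

/-! ### The oracle on its registers; weights of values as relative frequencies. -/

section Registers

variable {n m : ℕ}

/-- The contents of an index register and a value register. -/
abbrev QueryRegister (n m : ℕ) : Type := Fin (Nat.clog 2 n) ⊕ Fin (Nat.clog 2 m) → Bool

/-- The oracle on its own registers. -/
def registerQuery (A : Fin n → Fin m) (z : QueryRegister n m) : QueryRegister n m :=
  if h : Nat.ofBits (fun k => z (Sum.inl k)) < n then
    Sum.elim (fun k => z (Sum.inl k)) fun k => Bool.xor (z (Sum.inr k))
      ((A ⟨Nat.ofBits (fun k => z (Sum.inl k)), h⟩ : ℕ).testBit k)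
  else z

theorem registerQuery_involutive (A : Fin n → Fin m) : Function.Involutive (registerQuery A) := by
  intro z
  by_cases h : Nat.ofBits (fun k => z (Sum.inl k)) < n
  · ext (k | k)
    · simp [registerQuery, h]
    · simp [registerQuery, h]
  · simp [registerQuery, h]

/-- The oracle as a permutation of the contents of its registers. -/
def registerPerm (A : Fin n → Fin m) : Equiv.Perm (QueryRegister n m) :=
  (registerQuery_involutive A).toPerm

theorem registerPerm_apply (A : Fin n → Fin m) (z : QueryRegister n m) :
    registerPerm A z = registerQuery A z := rfl

theorem registerPerm_mul_self (A : Fin n → Fin m) : registerPerm A * registerPerm A = 1 :=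
  Equiv.ext fun z => registerQuery_involutive A z

theorem oracleMap_apply_wire {w : ℕ} (e : Fin (Nat.clog 2 n) ⊕ Fin (Nat.clog 2 m) ↪ Fin w)
    (A : Fin n → Fin m) (x : Bits w) (k : Fin (Nat.clog 2 n) ⊕ Fin (Nat.clog 2 m)) :
    oracleMap e A x (e k) = registerQuery A (fun k => x (e k)) k := by
  unfold oracleMap registerQuery
  split_ifs with h
  · rcases k with k | k <;> simp [e.injective.eq_iff]
  · rfl

theorem oracleMap_apply_of_forall_ne {w : ℕ}
    (e : Fin (Nat.clog 2 n) ⊕ Fin (Nat.clog 2 m) ↪ Fin w)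
    (A : Fin n → Fin m) (x : Bits w) (j : Fin w) (hj : ∀ k, e k ≠ j) :
    oracleMap e A x j = x j := by
  unfold oracleMap
  split_ifs with h
  · simp [hj]
  · rfl

/-- The register contents with index `i` and value `b`. -/
def registerState (n m i b : ℕ) : QueryRegister n m :=
  Sum.elim (fun k => i.testBit k) fun k => b.testBit k

theorem ofBits_testBit_of_lt {c i : ℕ} (h : i < 2 ^ c) :
    Nat.ofBits (fun k : Fin c => i.testBit k) = i := by
  rw [Nat.ofBits_testBit, Nat.mod_eq_of_lt h]

theorem ofBits_registerState (i : Fin n) (b : ℕ) :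
    Nat.ofBits (fun k => registerState n m i b (Sum.inl k)) = i :=
  ofBits_testBit_of_lt (i.2.trans_le (Nat.le_pow_clog one_lt_two n))

theorem registerQuery_registerState (A : Fin n → Fin m) (i : Fin n) :
    registerQuery A (registerState n m i 0) = registerState n m i (A i) := by
  unfold registerQuery
  rw [dif_pos (by rw [ofBits_registerState]; exact i.2)]
  ext (k | k)
  · rfl
  · simp only [ofBits_registerState, Fin.eta]
    simp [registerState]

/-- The uniform superposition of the indices of the array. -/
noncomputable def uniformState (n m : ℕ) (z : QueryRegister n m) : ℂ :=
  if Nat.ofBits (fun k => z (Sum.inl k)) < n ∧ ∀ k, z (Sum.inr k) = false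
    then (((√(n : ℝ))⁻¹ : ℝ) : ℂ) else 0

theorem exists_of_uniformState_ne_zero {z : QueryRegister n m} (h : uniformState n m z ≠ 0) :
    ∃ i : Fin n, z = registerState n m i 0 := by
  unfold uniformState at h
  split_ifs at h with h1
  · refine ⟨⟨_, h1.1⟩, ?_⟩
    ext (k | k)
    · simp only [registerState, Sum.elim_inl, Nat.testBit_ofBits, Fin.is_lt, dite_true, Fin.eta]
    · simp [registerState, h1.2]
  · exact absurd rfl h

theorem norm_sq_uniformState_registerState (i : Fin n) :
    ‖uniformState n m (registerState n m i 0)‖ ^ 2 = 1 / n := by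
  have hc : Nat.ofBits (fun k => registerState n m i 0 (Sum.inl k)) < n ∧
      ∀ k, registerState n m i 0 (Sum.inr k) = false :=
    ⟨by rw [ofBits_registerState]; exact i.2, fun k => by simp [registerState]⟩
  rw [uniformState, if_pos hc, Complex.norm_real, Real.norm_eq_abs, sq_abs, inv_pow,
    Real.sq_sqrt (by positivity), one_div]

theorem registerState_injective :
    Function.Injective fun i : Fin n => registerState n m i 0 := by
  intro i j h
  apply Fin.ext
  rw [← ofBits_registerState (m := m) i 0, ← ofBits_registerState (m := m) j 0]
  exact congrArg (fun z : QueryRegister n m => Nat.ofBits fun k => z (Sum.inl k)) h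

theorem sum_filter_uniformState (p : QueryRegister n m → Prop) [DecidablePred p] :
    ∑ z with p z, ‖uniformState n m z‖ ^ 2
      = ((Finset.univ.filter fun i : Fin n => p (registerState n m i 0)).card : ℝ) / n := by
  rw [Finset.sum_filter, ← Fintype.sum_of_injective _ (registerState_injective (n := n) (m := m))
    (fun i : Fin n => if p (registerState n m i 0) then (1 / n : ℝ) else 0)]
  · rw [← Finset.sum_filter, Finset.sum_const, nsmul_eq_mul, mul_one_div]
  · intro z hz
    by_cases hu : uniformState n m z = 0
    · simp [hu]
    · obtain ⟨i, rfl⟩ := exists_of_uniformState_ne_zero hu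
      exact absurd ⟨i, rfl⟩ hz
  · intro i
    rw [norm_sq_uniformState_registerState]

theorem sum_norm_sq_uniformState (hn : 1 ≤ n) : ∑ z, ‖uniformState n m z‖ ^ 2 = 1 := by
  have := sum_filter_uniformState (n := n) (m := m) fun _ => True
  simp only [Finset.filter_true, Finset.card_univ, Fintype.card_fin] at this
  rw [this, div_self]
  positivity

/-- The two value registers agree. -/
def sameValue (z v : QueryRegister n m) : Bool := decide (∀ k, z (Sum.inr k) = v (Sum.inr k))

theorem sameValue_registerState {i j : ℕ} {a b : Fin m} :
    sameValue (registerState n m i a) (registerState n m j b) ↔ a = b := by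
  simp only [sameValue, registerState, Sum.elim_inr]
  refine ⟨fun h => Fin.ext ?_, fun h => by simp [h]⟩
  have e : ∀ a : Fin m, Nat.ofBits (fun k : Fin (Nat.clog 2 m) => (a : ℕ).testBit k) = a :=
    fun a => ofBits_testBit_of_lt (a.2.trans_le (Nat.le_pow_clog one_lt_two m))
  rw [← e a, ← e b]
  exact congrArg Nat.ofBits (funext (of_decide_eq_true h))

theorem valueWeight_registerState (A : Fin n → Fin m) (i : Fin n) :
    valueWeight registerPerm (uniformState n m) sameValue A (registerState n m i (A i))
      = ((Finset.univ.filter fun j : Fin n => A j = A i).card : ℝ) / n := by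
  rw [valueWeight, sum_filter_uniformState]
  simp only [registerPerm_apply, registerQuery_registerState, sameValue_registerState]

theorem card_le_modalFrequency (A : Fin n → Fin m) (v : Fin m) :
    (Finset.univ.filter fun i : Fin n => A i = v).card ≤ modalFrequency A :=
  Finset.le_sup (f := fun v : Fin m => (Finset.univ.filter fun i : Fin n => A i = v).card)
    (Finset.mem_univ v)

theorem exists_card_eq_modalFrequency (hm : 1 ≤ m) (A : Fin n → Fin m) :
    ∃ v, (Finset.univ.filter fun i : Fin n => A i = v).card = modalFrequency A := by
  have : Nonempty (Fin m) := ⟨⟨0, hm⟩⟩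
  obtain ⟨v, _, hv⟩ := Finset.exists_mem_eq_sup Finset.univ Finset.univ_nonempty
    fun v : Fin m => (Finset.univ.filter fun i : Fin n => A i = v).card
  exact ⟨v, hv.symm⟩

theorem modalFrequency_le (A : Fin n → Fin m) : modalFrequency A ≤ n :=
  Finset.sup_le fun _ _ => (Finset.card_le_univ _).trans (by simp)

/-- Pigeonhole. This lower bound on the modal frequency makes relative accuracy possible. -/
theorem le_mul_modalFrequency (A : Fin n → Fin m) : n ≤ m * modalFrequency A := by
  have h := Finset.card_le_mul_card_image_of_maps_to (s := (Finset.univ : Finset (Fin n)))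
    (t := (Finset.univ : Finset (Fin m))) (f := A) (fun _ _ => Finset.mem_univ _)
    (modalFrequency A) fun v _ => card_le_modalFrequency A v
  simpa [mul_comm] using h

theorem isModalWeight_modalFrequency (hm : 1 ≤ m) (A : Fin n → Fin m) :
    IsModalWeight registerPerm (uniformState n m) sameValue A ((modalFrequency A : ℝ) / n) where
  le v hv := by
    obtain ⟨i, hi⟩ := exists_of_uniformState_ne_zero hv
    -- The query is an involution, so a state that it sends into the support of the uniform
    -- superposition is some |i, A[i]⟩.
    have : v = registerState n m i (A i) := by
      rw [← registerQuery_registerState, ← hi, registerPerm_apply, registerQuery_involutive A v]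
    rw [this, valueWeight_registerState]
    gcongr
    exact card_le_modalFrequency A _
  ge := by
    have e : ∑ v with valueWeight registerPerm (uniformState n m) sameValue A v
        = (modalFrequency A : ℝ) / n, ‖uniformState n m (registerPerm A v)‖ ^ 2
        = ∑ z with valueWeight registerPerm (uniformState n m) sameValue A (registerPerm A z)
          = (modalFrequency A : ℝ) / n, ‖uniformState n m z‖ ^ 2 := by
      rw [Finset.sum_filter, Finset.sum_filter, ← Equiv.sum_comp (registerPerm A)]
      refine Finset.sum_congr rfl fun z _ => ?_
      rw [registerPerm_apply, registerPerm_apply, registerQuery_involutive A z]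
    rw [e, sum_filter_uniformState]
    obtain ⟨v, hv⟩ := exists_card_eq_modalFrequency hm A
    gcongr
    rw [← hv]
    refine Finset.card_le_card fun i hi => ?_
    simp only [Finset.mem_filter, Finset.mem_univ, true_and] at hi ⊢
    rw [registerPerm_apply, registerQuery_registerState, valueWeight_registerState, hi, hv]

end Registers

/-! ### Binary search with comparisons that may err near the threshold. -/

section BinarySearch

variable {L : ℕ}

/-- The number with the first `j` binary digits in `t`. -/
noncomputable def bitSum (t : Bits L) (j : ℕ) : ℝ :=
  ∑ i : Fin L, if (i : ℕ) < j ∧ t i then (1 / 2 : ℝ) ^ (i + 1 : ℕ) else 0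

theorem bitSum_zero (t : Bits L) : bitSum t 0 = 0 := by simp [bitSum]

theorem bitSum_nonneg (t : Bits L) (j : ℕ) : 0 ≤ bitSum t j :=
  Finset.sum_nonneg fun _ _ => by positivity

theorem bitSum_succ (t : Bits L) (j : Fin L) :
    bitSum t (j + 1) = bitSum t j + if t j then (1 / 2 : ℝ) ^ (j + 1 : ℕ) else 0 := by
  have e : (if t j then (1 / 2 : ℝ) ^ (j + 1 : ℕ) else 0)
      = ∑ i : Fin L, if i = j then (if t i then (1 / 2 : ℝ) ^ (i + 1 : ℕ) else 0) else 0 := by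
    rw [Finset.sum_ite_eq' Finset.univ j fun i => if t i then (1 / 2 : ℝ) ^ (i + 1 : ℕ) else 0]
    simp
  rw [e, bitSum, bitSum, ← Finset.sum_add_distrib]
  refine Finset.sum_congr rfl fun i _ => ?_
  by_cases hij : i = j
  · subst hij; simp
  · have : (i : ℕ) < j + 1 ↔ (i : ℕ) < j := by
      have : (i : ℕ) ≠ j := fun h => hij (Fin.ext h)
      omega
    simp [hij, this]

theorem bitSum_update (t : Bits L) (j : Fin L) (c : Bool) {k : ℕ} (hk : k ≤ j) :
    bitSum (Function.update t j c) k = bitSum t k := by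
  refine Finset.sum_congr rfl fun i _ => ?_
  by_cases hij : i = j
  · subst hij
    simp [not_lt.2 hk]
  · simp [hij]

/-- The threshold of the `j`th comparison of the binary search with the earlier results `t`. -/
noncomputable def searchThreshold (t : Bits L) (j : ℕ) : ℝ := bitSum t j + (1 / 2) ^ (j + 1)

theorem searchThreshold_update (t : Bits L) (j : Fin L) (c : Bool) {k : ℕ} (hk : k ≤ j) :
    searchThreshold (Function.update t j c) k = searchThreshold t k := by
  rw [searchThreshold, bitSum_update t j c hk, searchThreshold]

/-- The `i`th comparison of `Φ` had a result that is right up to `Δ`, or `Φ` is below `Φ₀` and it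
had the result `false`. -/
def IsCorrectAt (Φ Φ₀ Δ : ℝ) (t : Bits L) (i : Fin L) : Prop :=
  (t i = true → searchThreshold t i - Δ < Φ) ∧
    (t i = false → Φ < Φ₀ ∨ Φ < searchThreshold t i + Δ)

/-- The first `j` comparisons had correct results. -/
def IsGoodHistory (Φ Φ₀ Δ : ℝ) (j : ℕ) (t : Bits L) : Prop :=
  (∀ i : Fin L, (i : ℕ) < j → IsCorrectAt Φ Φ₀ Δ t i) ∧ ∀ i : Fin L, j ≤ i → t i = false

theorem IsGoodHistory.update {Φ Φ₀ Δ : ℝ} {t : Bits L} {j : Fin L}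
    (h : IsGoodHistory Φ Φ₀ Δ j t) (c : Bool) (h₁ : c = true → searchThreshold t j - Δ < Φ)
    (h₂ : c = false → Φ < Φ₀ ∨ Φ < searchThreshold t j + Δ) :
    IsGoodHistory Φ Φ₀ Δ (j + 1) (Function.update t j c) := by
  refine ⟨fun i hi => ?_, fun i hi => ?_⟩
  · by_cases hij : i = j
    · subst hij
      simpa [IsCorrectAt, searchThreshold_update t i c le_rfl] using ⟨h₁, h₂⟩
    · have hlt : (i : ℕ) < j := by
        have : (i : ℕ) ≠ j := fun h => hij (Fin.ext h)
        omega
      simpa [IsCorrectAt, searchThreshold_update t j c hlt.le, hij] using h.1 i hlt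
  · have hij : i ≠ j := fun h => by subst h; omega
    simpa [hij] using h.2 i (by omega)

/-- The errors do not accumulate: the current interval is always known up to Δ on each side. A
result `true` renews the lower bound, and a result `false` renews the upper one. If Φ < Φ₀, wrong
results `false` are tolerated and only the lower bound is claimed. -/
theorem IsGoodHistory.bounds {Φ Φ₀ Δ : ℝ} {t : Bits L} (h : IsGoodHistory Φ Φ₀ Δ L t)
    (hΦ : 0 ≤ Φ) (hΦ1 : Φ ≤ 1) (hΔ : 0 ≤ Δ) :
    bitSum t L - Δ ≤ Φ ∧ (Φ < Φ₀ ∨ Φ ≤ bitSum t L + (1 / 2) ^ L + Δ) := by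
  have key : ∀ j ≤ L, bitSum t j - Δ ≤ Φ ∧ (Φ < Φ₀ ∨ Φ ≤ bitSum t j + (1 / 2) ^ j + Δ) := by
    intro j
    induction j with
    | zero =>
      intro _
      rw [bitSum_zero]
      exact ⟨by linarith, Or.inr (by norm_num; linarith)⟩
    | succ j ih =>
      intro hj
      obtain ⟨ih₁, ih₂⟩ := ih (by omega)
      obtain ⟨c₁, c₂⟩ := h.1 ⟨j, hj⟩ hj
      have e := bitSum_succ t ⟨j, hj⟩
      have e2 : (1 / 2 : ℝ) ^ j = (1 / 2) ^ (j + 1) + (1 / 2) ^ (j + 1) := by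
        rw [pow_succ]; ring
      simp only [searchThreshold] at c₁ c₂ e
      rw [e]
      cases ht : t ⟨j, hj⟩
      · simp only [Bool.false_eq_true, if_false, add_zero]
        exact ⟨ih₁, (c₂ ht).imp_right fun h => h.le⟩
      · simp only [if_true]
        refine ⟨(c₁ ht).le, ih₂.imp_right fun h => ?_⟩
        rw [e2] at h
        linarith
  exact key L le_rfl

/-- Write the result of a comparison into the bit `j` of the history. -/
def recordPerm {B : Type} (acc : B → Bool) (j : Fin L) : Equiv.Perm (B × Bits L) :=
  Function.Involutive.toPerm
    (fun a => (a.1, Function.update a.2 j (Bool.xor (a.2 j) (acc a.1)))) fun a => by simp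

/-- From a basis state of the history, the controlled test does not change the history, so only the
test with parameter `t` runs before its result is written. -/
theorem sum_norm_sq_record {B T : Type} [Fintype B] [DecidableEq B] [Fintype T] [DecidableEq T]
    (f : T → unitaryGroup B ℂ) (σ : Equiv.Perm (B × T)) (b₀ : B) (t : T) (bad : T → Prop)
    [DecidablePred bad] :
    ∑ a with bad a.2, ‖((permGate σ * ctrl f : unitaryGroup (B × T) ℂ) :
        Matrix (B × T) (B × T) ℂ) a (b₀, t)‖ ^ 2
      = ∑ b with bad (σ (b, t)).2, ‖((f t : Matrix B B ℂ) *ᵥ basisState b₀) b‖ ^ 2 := by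
  have e : ∀ a, ((permGate σ * ctrl f : unitaryGroup (B × T) ℂ) :
        Matrix (B × T) (B × T) ℂ) a (b₀, t)
      = (ctrl f : Matrix (B × T) (B × T) ℂ) (σ.symm a) (b₀, t) := by
    intro a
    rw [← mulVec_basisState ((permGate σ * ctrl f : unitaryGroup (B × T) ℂ) :
      Matrix (B × T) (B × T) ℂ) (b₀, t) a, coe_mul_mulVec, permGate_mulVec, mulVec_basisState]
  simp only [e]
  rw [Finset.sum_filter, ← Equiv.sum_comp σ, Fintype.sum_prod_type_right, Finset.sum_eq_single t,
    Finset.sum_filter]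
  · refine Finset.sum_congr rfl fun b _ => ?_
    rw [Equiv.symm_apply_apply, ctrl_apply, if_pos rfl, mulVec_basisState]
  · intro t' _ ht'
    refine Finset.sum_eq_zero fun b _ => ?_
    rw [Equiv.symm_apply_apply, ctrl_apply, if_neg ht']
    simp
  · simp

theorem ctrl_const_permGate {B T : Type} [Fintype B] [DecidableEq B] [Fintype T] [DecidableEq T]
    (σ : Equiv.Perm B) :
    (ctrl fun _ : T => permGate σ) = permGate (σ.prodCongr (Equiv.refl T)) := by
  apply ext_mulVec
  intro ψ
  ext ⟨b, t⟩
  rw [ctrl_mulVec, permGate_mulVec, permGate_mulVec]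
  rfl

end BinarySearch

/-! ### Placement of the registers on numbered wires. -/

section Wires

/-- The wires of all registers but the history. -/
abbrev WorkWires (n m d d' : ℕ) : Type :=
  (((Fin (Nat.clog 2 n) ⊕ Fin (Nat.clog 2 m)) ⊕ Fin d) ⊕
    (Fin (Nat.clog 2 n) ⊕ Fin (Nat.clog 2 m))) ⊕ Fin d'

/-- The contents of all registers but the history. -/
abbrev WorkSpace (n m d d' : ℕ) : Type :=
  ((QueryRegister n m × Bits d) × QueryRegister n m) × Bits d'

/-- All registers but the history, in the initial state. -/
def blankWork (n m d d' : ℕ) : WorkSpace n m d d' :=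
  (((fun _ => false, fun _ => false), fun _ => false), fun _ => false)

/-- The contents of the registers as a function of the wires. -/
def registersEquiv (n m d d' L : ℕ) :
    WorkSpace n m d d' × Bits L ≃ (WorkWires n m d d' ⊕ Fin L → Bool) where
  toFun a := Sum.elim (Sum.elim (Sum.elim (Sum.elim a.1.1.1.1 a.1.1.1.2) a.1.1.2) a.1.2) a.2
  invFun x := (((((fun k => x (.inl (.inl (.inl (.inl k)))), fun k => x (.inl (.inl (.inl (.inr k))))),
    fun k => x (.inl (.inl (.inr k)))), fun k => x (.inl (.inr k)))), fun k => x (.inr k))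
  left_inv _ := rfl
  right_inv x := by ext ((((k | k) | k) | k) | k) <;> rfl

/-- The number of wires. -/
abbrev numWires (n m d d' L : ℕ) : ℕ := Fintype.card (WorkWires n m d d' ⊕ Fin L)

theorem numWires_eq (n m d d' L : ℕ) :
    numWires n m d d' L = 2 * Nat.clog 2 n + 2 * Nat.clog 2 m + d + d' + L := by
  simp only [Fintype.card_sum, Fintype.card_fin]
  ring

/-- The numbering of the wires. -/
noncomputable def wire (n m d d' L : ℕ) :
    WorkWires n m d d' ⊕ Fin L ≃ Fin (numWires n m d d' L) :=
  Fintype.equivFin _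

/-- The contents of the registers as a bit string. -/
noncomputable def layout (n m d d' L : ℕ) :
    WorkSpace n m d d' × Bits L ≃ Bits (numWires n m d d' L) :=
  (registersEquiv n m d d' L).trans ((wire n m d d' L).arrowCongr (Equiv.refl Bool))

variable {n m d d' L : ℕ}

theorem layout_apply_wire (a : WorkSpace n m d d' × Bits L) (k : WorkWires n m d d' ⊕ Fin L) :
    layout n m d d' L a (wire n m d d' L k) = registersEquiv n m d d' L a k := by
  simp [layout, Equiv.arrowCongr]

/-- The wires of the first query register. -/
noncomputable def queryWires (n m d d' L : ℕ) :
    Fin (Nat.clog 2 n) ⊕ Fin (Nat.clog 2 m) ↪ Fin (numWires n m d d' L) :=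
  ⟨fun k => wire n m d d' L (.inl (.inl (.inl (.inl k)))), fun a b h => by
    simpa using (wire n m d d' L).injective h⟩

/-- The oracle applied to the first query register. -/
def workQuery (n m d d' L : ℕ) (A : Fin n → Fin m) :
    Equiv.Perm (WorkSpace n m d d' × Bits L) :=
  ((((registerPerm A).prodCongr (Equiv.refl _)).prodCongr (Equiv.refl _)).prodCongr
    (Equiv.refl _)).prodCongr (Equiv.refl _)

theorem layout_workQuery (A : Fin n → Fin m) (a : WorkSpace n m d d' × Bits L) :
    layout n m d d' L (workQuery n m d d' L A a)
      = oracleMap (queryWires n m d d' L) A (layout n m d d' L a) := by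
  ext j
  obtain ⟨k, rfl⟩ := (wire n m d d' L).surjective j
  rw [layout_apply_wire]
  have hne : ∀ k, (∀ k', k ≠ .inl (.inl (.inl (.inl k')))) →
      oracleMap (queryWires n m d d' L) A (layout n m d d' L a) (wire n m d d' L k)
        = registersEquiv n m d d' L a k := by
    intro k hk
    rw [oracleMap_apply_of_forall_ne, layout_apply_wire]
    exact fun k' h => hk k' ((wire n m d d' L).injective h).symm
  rcases k with (((k | k) | k) | k) | k
  · refine Eq.trans ?_ (oracleMap_apply_wire (queryWires n m d d' L) A _ k).symm
    have : (fun k => layout n m d d' L a (queryWires n m d d' L k)) = a.1.1.1.1 := by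
      ext k
      exact layout_apply_wire a _
    rw [this]
    rfl
  all_goals
    rw [hne _ (by simp)]
    rfl

/-- All wires but those of the history. -/
noncomputable def workWireList (n m d d' L : ℕ) : List (Fin (numWires n m d d' L)) :=
  (Finset.univ : Finset (WorkWires n m d d')).toList.map fun k => wire n m d d' L (.inl k)

theorem clearBits_layout (b : WorkSpace n m d d') (t : Bits L) :
    clearBits (workWireList n m d d' L) (layout n m d d' L (b, t))
      = layout n m d d' L (blankWork n m d d', t) := by
  ext j
  obtain ⟨k, rfl⟩ := (wire n m d d' L).surjective j
  rw [clearBits, layout_apply_wire, layout_apply_wire]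
  rcases k with k | k
  · rw [if_pos (by simp [workWireList])]
    rcases k with ((k | k) | k) | k <;> rfl
  · rw [if_neg (by simp [workWireList])]
    rfl

theorem layout_blank :
    layout n m d d' L (blankWork n m d d', fun _ => false) = fun _ => false := by
  ext j
  obtain ⟨k, rfl⟩ := (wire n m d d' L).surjective j
  rw [layout_apply_wire]
  rcases k with (((k | k) | k) | k) | k <;> rfl

end Wires

/-! ### The complete search as a query algorithm. -/

section Search

variable {n m d d' L : ℕ}

/-- The sequence of threshold tests, each with the result recorded in the history. -/
noncomputable def searchRound (hn : 1 ≤ n) (F C : unitaryGroup (Bits d) ℂ) (κ : Bits d → ℕ)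
    (P : unitaryGroup ((QueryRegister n m × Bits d) × QueryRegister n m) ℂ)
    (F' C' : unitaryGroup (Bits d') ℂ) (κ' : Bits d' → ℕ) (s : ℝ) (j : Fin L)
    (A : Fin n → Fin m) : unitaryGroup (WorkSpace n m d d' × Bits L) ℂ :=
  permGate (recordPerm (fun b : WorkSpace n m d d' => acceptFound κ' (2 ^ d') s b.2) j) *
    ctrl fun t => thresholdTest registerPerm (uniformState n m) (sum_norm_sq_uniformState hn)
      sameValue F C κ (2 ^ d) P (blankWork n m d d').1 F' C' κ' (searchThreshold t j) A

theorem searchRound_exists_steps (hn : 1 ≤ n) (F C : unitaryGroup (Bits d) ℂ) (κ : Bits d → ℕ)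
    (hκ : ∀ y, κ y ≤ 2 ^ d)
    (P : unitaryGroup ((QueryRegister n m × Bits d) × QueryRegister n m) ℂ)
    (F' C' : unitaryGroup (Bits d') ℂ) (κ' : Bits d' → ℕ) (hκ' : ∀ y, κ' y ≤ 2 ^ d') (s : ℝ)
    (j : Fin L) :
    ∃ c : List (QStep n m (numWires n m d d' L)), c.countP QStep.isQuery
        = 2 ^ d' * (2 * (2 ^ d * 2 + 1)) + (2 ^ d * 2 + 1) ∧ ∀ A ρ, runSteps A c ρ
      = (transportGate (layout n m d d' L) (searchRound hn F C κ P F' C' κ' s j A) :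
          Matrix (Bits (numWires n m d d' L)) (Bits (numWires n m d d' L)) ℂ) * ρ *
        (transportGate (layout n m d d' L) (searchRound hn F C κ P F' C' κ' s j A) :
          Matrix (Bits (numWires n m d d' L)) (Bits (numWires n m d d' L)) ℂ)ᴴ := by
  have h1 := ((thresholdTest_computable (q := registerPerm) (u := uniformState n m)
    (same := sameValue) (F := F) (C := C) (P := P) (x₀ := (blankWork n m d d').1)
    registerPerm_mul_self (sum_norm_sq_uniformState hn) hκ F' C' κ' hκ'
    (fun t : Bits L => searchThreshold t j)).comap (fun s : Unit × Bits L => s.2)).ctrl (T := Unit)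
  have hQ : (fun A => ctrl fun _ : Bits L => ctrl fun _ : Bits d' =>
      ctrl fun _ : QueryRegister n m => ctrl fun _ : Bits d => permGate (registerPerm A))
      = fun A => permGate (workQuery n m d d' L A) := by
    funext A
    simp only [ctrl_const_permGate]
    rfl
  rw [hQ] at h1
  have h2 := (QueryComputable.const fun _ : Unit => permGate
    (recordPerm (fun b : WorkSpace n m d d' => acceptFound κ' (2 ^ d') s b.2) j)).mul h1
  rw [zero_add] at h2
  exact h2.exists_steps (layout n m d d' L) (queryWires n m d d' L) (workQuery n m d d' L)
    layout_workQuery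

-- There are three cases. If Φ is at least Δ below the threshold, only a false acceptance is bad. If
-- Φ is at least Δ above it and at least 8s², only a false rejection is bad. Otherwise both results
-- are permitted.
open Classical in
theorem searchRound_bad_le (hn : 1 ≤ n) (hm : 1 ≤ m) {F C : unitaryGroup (Bits d) ℂ}
    {κ : Bits d → ℕ} {y₀ : Bits d} {M r : ℕ} (hE : IsPhaseEstimator κ F C y₀ (2 ^ d) M r)
    {P : unitaryGroup ((QueryRegister n m × Bits d) × QueryRegister n m) ℂ}
    (hP : (P : Matrix ((QueryRegister n m × Bits d) × QueryRegister n m)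
      ((QueryRegister n m × Bits d) × QueryRegister n m) ℂ) *ᵥ basisState (blankWork n m d d').1
      = fun a => uniformState n m a.1.1 * basisState y₀ a.1.2 * uniformState n m a.2)
    {F' C' : unitaryGroup (Bits d') ℂ} {κ' : Bits d' → ℕ} {M' r' : ℕ}
    (hE' : IsPhaseEstimator κ' F' C' (blankWork n m d d').2 (2 ^ d') M' r') {s Δ : ℝ}
    (hM : 4 ≤ M * Δ) (hΔ : 0 < Δ) (hM' : 4 ≤ M' * s) (hs : 0 ≤ s)
    (hr : (2 ^ d : ℝ) * (1 / 4) ^ r ≤ s ^ 2 / 4) (hr2 : (2 ^ d : ℝ) * (1 / 4) ^ r ≤ 1 / 2)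
    (A : Fin n → Fin m) (j : Fin L) (t : Bits L)
    (ht : IsGoodHistory ((modalFrequency A : ℝ) / n) (8 * s ^ 2) Δ j t) :
    ∑ a with ¬ IsGoodHistory ((modalFrequency A : ℝ) / n) (8 * s ^ 2) Δ (j + 1) a.2,
      ‖(searchRound hn F C κ P F' C' κ' s j A :
        Matrix (WorkSpace n m d d' × Bits L) (WorkSpace n m d d' × Bits L) ℂ) a
          (blankWork n m d d', t)‖ ^ 2 ≤ 2 ^ d' * (1 / 4) ^ r' := by
  set Φ := (modalFrequency A : ℝ) / n with hΦ
  have hmod := isModalWeight_modalFrequency hm A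
  rw [searchRound, sum_norm_sq_record _ _ _ _
    fun t => ¬ IsGoodHistory Φ (8 * s ^ 2) Δ (j + 1) t]
  -- The result is written by XOR, so the bit must still be blank. This is why a good history has
  -- `false` at all later positions.
  have htj : t j = false := ht.2 j le_rfl
  have hrec : ∀ b : WorkSpace n m d d',
      (recordPerm (fun b : WorkSpace n m d d' => acceptFound κ' (2 ^ d') s b.2) j (b, t)).2
        = Function.update t j (acceptFound κ' (2 ^ d') s b.2) := by
    intro b
    change Function.update t j (Bool.xor (t j) (acceptFound κ' (2 ^ d') s b.2)) = _
    rw [htj, Bool.false_xor]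
  simp only [hrec]
  have hc : (Fintype.card (Bits d) : ℝ) = 2 ^ d := by simp
  have hc' : (Fintype.card (Bits d') : ℝ) = 2 ^ d' := by simp
  by_cases hlow : Φ ≤ searchThreshold t j - Δ
  · have h := thresholdTest_accept_le (D := 2 ^ d) registerPerm_mul_self
      (sum_norm_sq_uniformState hn) hE hE' hP
      hmod (θ := searchThreshold t j) hM hM' hlow hs (by rwa [hc])
    rw [hc'] at h
    refine le_trans (Finset.sum_le_sum_of_subset_of_nonneg ?_ fun _ _ _ => by positivity) h
    intro b hb
    simp only [Finset.mem_filter, Finset.mem_univ, true_and] at hb ⊢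
    by_contra hacc
    refine hb (ht.update _ (fun h => absurd h hacc) fun _ => Or.inr ?_)
    linarith
  · by_cases hhigh : Φ < 8 * s ^ 2 ∨ Φ < searchThreshold t j + Δ
    · rw [Finset.filter_false_of_mem, Finset.sum_empty]
      · positivity
      · intro b _
        rw [not_not]
        exact ht.update _ (fun _ => not_le.1 hlow) fun _ => hhigh
    · push Not at hhigh
      have h := thresholdTest_reject_le (D := 2 ^ d) registerPerm_mul_self
        (sum_norm_sq_uniformState hn) hE hE'
        hP hmod (θ := searchThreshold t j) hM hM' hhigh.2 hhigh.1 (by rwa [hc])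
      rw [hc'] at h
      refine le_trans (Finset.sum_le_sum_of_subset_of_nonneg ?_ fun _ _ _ => by positivity) h
      intro b hb
      simp only [Finset.mem_filter, Finset.mem_univ, true_and] at hb ⊢
      by_contra hacc
      refine hb (ht.update _ (fun _ => not_le.1 hlow) fun h => absurd ?_ hacc)
      simp [h]

/-- All registers but the history are blank, and the history is good. -/
def IsGoodState (Φ Φ₀ Δ : ℝ) (j : ℕ) (x : Bits (numWires n m d d' L)) : Prop :=
  ∃ t, x = layout n m d d' L (blankWork n m d d', t) ∧ IsGoodHistory Φ Φ₀ Δ j t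

open Classical in
theorem transportGate_bad_le (U : unitaryGroup (WorkSpace n m d d' × Bits L) ℂ)
    (Φ Φ₀ Δ η : ℝ) (j : ℕ) (t : Bits L)
    (h : ∑ a with ¬ IsGoodHistory Φ Φ₀ Δ (j + 1) a.2,
      ‖(U : Matrix (WorkSpace n m d d' × Bits L) (WorkSpace n m d d' × Bits L) ℂ) a
        (blankWork n m d d', t)‖ ^ 2 ≤ η) :
    ∑ x with ¬ IsGoodState Φ Φ₀ Δ (j + 1) (clearBits (workWireList n m d d' L) x),
      ‖(transportGate (layout n m d d' L) U :
        Matrix (Bits (numWires n m d d' L)) (Bits (numWires n m d d' L)) ℂ) x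
          (layout n m d d' L (blankWork n m d d', t))‖ ^ 2 ≤ η := by
  refine le_trans ?_ h
  rw [Finset.sum_filter, Finset.sum_filter, ← Equiv.sum_comp (layout n m d d' L)]
  refine Finset.sum_le_sum fun a _ => ?_
  have e1 : (transportGate (layout n m d d' L) U :
      Matrix (Bits (numWires n m d d' L)) (Bits (numWires n m d d' L)) ℂ) (layout n m d d' L a)
        (layout n m d d' L (blankWork n m d d', t)) =
      (U : Matrix (WorkSpace n m d d' × Bits L) (WorkSpace n m d d' × Bits L) ℂ) a
        (blankWork n m d d', t) := by
    simp [transportGate]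
  rw [e1]
  by_cases hg : IsGoodHistory Φ Φ₀ Δ (j + 1) a.2
  · rw [if_neg (not_not.2 ⟨a.2, clearBits_layout a.1 a.2, hg⟩)]
    split_ifs
    positivity
  · rw [if_pos hg]
    split_ifs
    · positivity
    · exact le_rfl

theorem exists_searchAlgorithm (hn : 1 ≤ n) (hm : 1 ≤ m) {k r : ℕ} (hk : 1 ≤ k)
    (hd : r * (4 * 2 ^ L) < 2 ^ d) (hd' : r * (8 * k) < 2 ^ d')
    (hr : (2 ^ d : ℝ) * (1 / 4) ^ r ≤ 1 / (16 * k ^ 2)) (g : ℝ → ℝ) :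
    ∃ P : QueryAlgorithm n m,
      P.queries = L * (2 ^ d' * (2 * (2 ^ d * 2 + 1)) + (2 ^ d * 2 + 1)) ∧
      P.qubits = 2 * Nat.clog 2 n + 2 * Nat.clog 2 m + d + d' + L ∧
      ∀ A S, (∀ x, 0 ≤ x → x - (1 / 2) ^ L ≤ (modalFrequency A : ℝ) / n →
        ((modalFrequency A : ℝ) / n < 2 / k ^ 2 ∨
          (modalFrequency A : ℝ) / n ≤ x + 2 * (1 / 2) ^ L) → g x ∈ S) →
        1 - L * (2 ^ d' * (1 / 4) ^ r) ≤ P.prob A S := by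
  classical
  have hk0 : (0 : ℝ) < k := by exact_mod_cast hk
  -- The inner precision is Δ = 2^(-L) with M = 4·2^L, and the outer one is s with M' = 8k. Then MΔ
  -- = M's = 4, as the tests require, and the cutoff 8s² is 2/k².
  set s : ℝ := 1 / (2 * k) with hs
  have hs0 : 0 ≤ s := by positivity
  have hΔ : (0 : ℝ) < (1 / 2) ^ L := by positivity
  have hs2 : s ^ 2 / 4 = 1 / (16 * k ^ 2) := by rw [hs]; field_simp; norm_num
  have hs8 : 8 * s ^ 2 = 2 / k ^ 2 := by rw [hs]; field_simp; norm_num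
  have hr2 : (2 ^ d : ℝ) * (1 / 4) ^ r ≤ 1 / 2 := by
    refine hr.trans ?_
    rw [div_le_div_iff₀ (by positivity) (by norm_num)]
    have : (1 : ℝ) ≤ k := by exact_mod_cast hk
    nlinarith
  have hM : (4 : ℝ) ≤ (4 * 2 ^ L : ℕ) * (1 / 2) ^ L := by
    push_cast
    rw [mul_assoc, ← mul_pow]
    norm_num
  have hM' : (4 : ℝ) ≤ (8 * k : ℕ) * s := by
    push_cast
    rw [hs]
    field_simp
    norm_num
  obtain ⟨e⟩ : Nonempty (Bits d ≃ Fin (2 ^ d)) := ⟨Fintype.equivFinOfCardEq (by simp)⟩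
  obtain ⟨e'⟩ : Nonempty (Bits d' ≃ Fin (2 ^ d')) := ⟨Fintype.equivFinOfCardEq (by simp)⟩
  obtain ⟨F, C, hE⟩ := exists_phaseEstimator e (fun _ => false)
    (Nat.one_le_iff_ne_zero.2 (by positivity)) hd
  obtain ⟨F', C', hE'⟩ := exists_phaseEstimator e' (fun _ => false)
    (Nat.one_le_iff_ne_zero.2 (by positivity)) hd'
  have hu := sum_norm_sq_uniformState (m := m) hn
  obtain ⟨P, hP⟩ := exists_prepGate (blankWork n m d d').1 (fun a : (QueryRegister n m × Bits d) ×
      QueryRegister n m => uniformState n m a.1.1 * basisState (fun _ => false) a.1.2 *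
        uniformState n m a.2) (by
    rw [Fintype.sum_prod_type]
    simp only [norm_mul _ (uniformState n m _), mul_pow _ ‖uniformState n m _‖, ← Finset.mul_sum,
      hu, mul_one]
    exact sum_norm_sq_mul_basisState hu _)
  obtain ⟨c, hc, h⟩ := exists_steps_rounds _ L
    (fun j A => transportGate (layout n m d d' L)
      (searchRound hn F C (fun y => (e y : ℕ)) P F' C' (fun y => (e' y : ℕ)) s j A))
    (fun j => searchRound_exists_steps hn F C (fun y => (e y : ℕ)) (fun y => (e y).2.le) P F' C'
      (fun y => (e' y : ℕ)) (fun y => (e' y).2.le) s j)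
    (workWireList n m d d' L)
    (fun A => IsGoodState ((modalFrequency A : ℝ) / n) (8 * s ^ 2) ((1 / 2) ^ L))
    (fun A => ⟨fun _ => false, layout_blank.symm,
      ⟨fun i hi => absurd hi (Nat.not_lt_zero _), fun _ _ => rfl⟩⟩)
    (2 ^ d' * (1 / 4) ^ r) (by
      rintro A j _ ⟨t, rfl, ht⟩
      exact transportGate_bad_le _ _ _ _ _ _ _ (searchRound_bad_le hn hm hE hP hE' hM
        hΔ hM' hs0 (by rw [hs2]; exact hr) hr2 A j t ht))
  refine ⟨⟨numWires n m d d' L, c, fun x => g (bitSum ((layout n m d d' L).symm x).2 L)⟩, hc, numWires_eq n m d d' L,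
    fun A S hS => ?_⟩
  obtain ⟨p, hp, hp0, hp1⟩ := h A
  refine hp1.trans ?_
  rw [QueryAlgorithm.prob, Finset.sum_filter]
  refine Finset.sum_le_sum fun x _ => ?_
  have hfin : (QueryAlgorithm.finalState ⟨numWires n m d d' L, c,
      fun x => g (bitSum ((layout n m d d' L).symm x).2 L)⟩ A x x).re = p x := by
    have : QueryAlgorithm.finalState ⟨numWires n m d d' L, c,
      fun x => g (bitSum ((layout n m d d' L).symm x).2 L)⟩ A = diagonal fun x => (p x : ℂ) := hp
    rw [this, diagonal_apply_eq, Complex.ofReal_re]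
  rw [hfin]
  by_cases hx : IsGoodState ((modalFrequency A : ℝ) / n) (8 * s ^ 2) ((1 / 2) ^ L) L x
  · rw [if_pos hx]
    obtain ⟨t, rfl, ht⟩ := hx
    have hΦ1 : (modalFrequency A : ℝ) / n ≤ 1 :=
      div_le_one_of_le₀ (by exact_mod_cast modalFrequency_le A) (Nat.cast_nonneg _)
    have hΦ0 : 0 ≤ (modalFrequency A : ℝ) / n :=
      div_nonneg (Nat.cast_nonneg _) (Nat.cast_nonneg _)
    have hb := ht.bounds hΦ0 hΦ1 hΔ.le
    rw [hs8] at hb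
    rw [if_pos]
    simp only [Equiv.symm_apply_apply]
    refine hS _ (bitSum_nonneg t L) hb.1 (hb.2.imp_right fun h => ?_)
    linarith
  · rw [if_neg hx]
    split_ifs
    · exact hp0 x
    · exact le_rfl

end Search

/-! ### Choice of the parameters and their logarithmic size. -/

section Parameters

variable {n m : ℕ}

/-- The constant 3/2 here and below is an upper bound for 1/log 2. -/
theorem clog_two_le {x : ℕ} (hx : 1 ≤ x) : (Nat.clog 2 x : ℝ) ≤ 3 / 2 * Real.log x + 1 := by
  have h2 := Real.log_two_gt_d9
  rcases hx.eq_or_lt with rfl | hx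
  · simp
  have h1 : 2 ^ (Nat.clog 2 x - 1) < x := Nat.pow_pred_clog_lt_self one_lt_two hx
  have h3 : ((Nat.clog 2 x - 1 : ℕ) : ℝ) * Real.log 2 ≤ Real.log x := by
    rw [← Real.log_pow]
    exact Real.log_le_log (by positivity) (by exact_mod_cast h1.le)
  have h4 : (Nat.clog 2 x : ℝ) ≤ ((Nat.clog 2 x - 1 : ℕ) : ℝ) + 1 := by
    exact_mod_cast (by omega)
  have h5 : (0 : ℝ) ≤ ((Nat.clog 2 x - 1 : ℕ) : ℝ) := Nat.cast_nonneg _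
  nlinarith

theorem exists_pow_two_between {a : ℝ} (ha : 1 ≤ a) :
    ∃ L : ℕ, a ≤ 2 ^ L ∧ (2 : ℝ) ^ L ≤ 2 * a ∧ (L : ℝ) ≤ 3 / 2 * Real.log a + 1 := by
  have h2 := Real.log_two_gt_d9
  obtain ⟨L, h1, h3⟩ := exists_nat_pow_near ha one_lt_two
  refine ⟨L + 1, h3.le, by rw [pow_succ]; linarith, ?_⟩
  have h4 : (L : ℝ) * Real.log 2 ≤ Real.log a := by
    rw [← Real.log_pow]
    exact Real.log_le_log (by positivity) h1
  push_cast
  nlinarith [Nat.cast_nonneg (α := ℝ) L]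

theorem exists_pow_two_gt (y : ℕ) (hy : 1 ≤ y) :
    ∃ d : ℕ, y < 2 ^ d ∧ (2 : ℝ) ^ d ≤ 2 * y ∧ (d : ℝ) ≤ 3 / 2 * Real.log y + 1 := by
  have hy0 : y ≠ 0 := by omega
  refine ⟨Nat.log 2 y + 1, Nat.lt_pow_succ_log_self one_lt_two y, ?_, ?_⟩
  · have := Nat.pow_log_le_self 2 hy0
    rw [pow_succ, mul_comm]
    gcongr
    exact_mod_cast this
  · have h1 : (Nat.log 2 y : ℝ) * Real.log 2 ≤ Real.log y := by
      rw [← Real.log_pow]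
      exact Real.log_le_log (by positivity) (by exact_mod_cast Nat.pow_log_le_self 2 hy0)
    have h2 := Real.log_two_gt_d9
    push_cast
    nlinarith [Nat.cast_nonneg (α := ℝ) (Nat.log 2 y)]

theorem exists_nat_sq_between {K : ℝ} (hK : 1 ≤ K) :
    ∃ k : ℕ, 1 ≤ k ∧ 2 * K ≤ (k : ℝ) ^ 2 ∧ (k : ℝ) ≤ 3 * √K ∧ (k : ℝ) ^ 2 ≤ 9 * K := by
  have hk1 := Nat.le_ceil (√(2 * K))
  have hk1' : (1 : ℝ) ≤ √(2 * K) := Real.one_le_sqrt.2 (by linarith)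
  have hsK : 1 ≤ √K := Real.one_le_sqrt.2 hK
  have h1 : (⌈√(2 * K)⌉₊ : ℝ) < √(2 * K) + 1 := Nat.ceil_lt_add_one (Real.sqrt_nonneg _)
  have h2 : √(2 * K) ≤ 3 / 2 * √K := by
    rw [Real.sqrt_mul zero_le_two]
    gcongr
    rw [Real.sqrt_le_left (by norm_num)]
    norm_num
  have h3 : (⌈√(2 * K)⌉₊ : ℝ) ≤ 3 * √K := by linarith
  refine ⟨⌈√(2 * K)⌉₊, by exact_mod_cast hk1'.trans hk1, ?_, h3, ?_⟩
  · exact (Real.sq_sqrt (show 0 ≤ 2 * K by linarith)).ge.trans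
      (pow_le_pow_left₀ (Real.sqrt_nonneg _) hk1 2)
  · refine (pow_le_pow_left₀ (Nat.cast_nonneg _) h3 2).trans_eq ?_
    rw [mul_pow, Real.sq_sqrt (by linarith)]
    norm_num

/-- The register sizes grow with r, so the error bounds contain r·4^(-r). One factor 2^(-r) absorbs
r and the other gives 1/a. -/
theorem mul_quarter_pow_le {a : ℝ} {r : ℕ} (hr : a ≤ 2 ^ r) (ha : 0 < a) :
    (r : ℝ) * (1 / 4) ^ r ≤ 1 / a := by
  have h1 : (r : ℝ) ≤ 2 ^ r := by exact_mod_cast Nat.lt_two_pow_self.le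
  have h2 : (1 / 4 : ℝ) ^ r = 1 / (2 ^ r * 2 ^ r) := by
    rw [← mul_pow, div_pow, one_pow]; norm_num
  rw [h2, mul_one_div, div_le_div_iff₀ (by positivity) ha, one_mul]
  exact mul_le_mul h1 hr ha.le (by positivity)

theorem exists_estimator (hn : 1 ≤ n) (hm : 1 ≤ m) {K N δ : ℝ} (hK : 1 ≤ K) (hN : 1 ≤ N)
    (hδ : 0 < δ) (hδ1 : δ < 1) (g : ℝ → ℝ) :
    ∃ P : QueryAlgorithm n m,
      (P.queries : ℝ) ≤ 3000000 * (1 + Real.log (K * N / δ)) ^ 3 * (N * √K) ∧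
      (P.qubits : ℝ) ≤ 100 * (1 + Real.log (K * N / δ) + Real.log n + Real.log m) ∧
      ∀ A S, (∀ x, 0 ≤ x → x - 1 / N ≤ (modalFrequency A : ℝ) / n →
        ((modalFrequency A : ℝ) / n < 1 / K ∨ (modalFrequency A : ℝ) / n ≤ x + 2 / N) → g x ∈ S) →
        1 - δ ≤ P.prob A S := by
  have hK0 : 0 < K := by linarith
  have hN0 : 0 < N := by linarith
  -- The inequality 2K ≤ k² puts the cutoff 2/k² below 1/K.
  obtain ⟨k, hk2, hk5, hk3, hk4⟩ := exists_nat_sq_between hK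
  have hk2' : (1 : ℝ) ≤ k := by exact_mod_cast hk2
  have hk6 : (k : ℝ) ≤ k ^ 2 := le_self_pow₀ hk2' two_ne_zero
  obtain ⟨L, hL1, hL2, hL3⟩ := exists_pow_two_between hN
  have hL4 : (L : ℝ) ≤ 2 ^ L := by exact_mod_cast Nat.lt_two_pow_self.le
  have hpL : (1 : ℝ) ≤ 2 ^ L := one_le_pow₀ one_le_two
  -- With 2^d ≤ 8r·2^L, the inner error times 16k² is at most 128k²·2^L·r·4^(-r). The same quantity
  -- bounds the total outer error L·2^(d')·4^(-r), so this choice makes both at most δ.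
  set a : ℝ := 128 * k ^ 2 * 2 ^ L / δ with ha
  have hkL : (1 : ℝ) ≤ k ^ 2 * 2 ^ L := one_le_mul_of_one_le_of_one_le (one_le_pow₀ hk2') hpL
  have ha1 : 1 ≤ a := by
    rw [ha, le_div_iff₀ hδ]
    linarith
  obtain ⟨r, hr1, -, hr3⟩ := exists_pow_two_between ha1
  set X := Real.log (K * N / δ) with hX
  have hKN : 1 ≤ K * N := one_le_mul_of_one_le_of_one_le hK hN
  have hKNδ : K * N ≤ K * N / δ := by
    rw [le_div_iff₀ hδ]
    exact mul_le_of_le_one_right (by positivity) hδ1.le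
  have hX0 : 0 ≤ X := Real.log_nonneg (hKN.trans hKNδ)
  have hlogN : Real.log N ≤ X := Real.log_le_log hN0
    ((le_mul_of_one_le_left hN0.le hK).trans hKNδ)
  have hlogK : Real.log K ≤ X := Real.log_le_log hK0
    ((le_mul_of_one_le_right hK0.le hN).trans hKNδ)
  have hlog2 := Real.log_two_lt_d9
  have hla : Real.log a ≤ 9 + X := by
    have h1 : a ≤ 2 ^ 12 * (K * N / δ) := by
      rw [ha, mul_div_assoc', div_le_div_iff_of_pos_right hδ]
      have : (k : ℝ) ^ 2 * 2 ^ L ≤ 9 * K * (2 * N) := mul_le_mul hk4 hL2 (by positivity)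
        (by positivity)
      linarith
    have h2 := Real.log_le_log (by linarith) h1
    rw [Real.log_mul (by positivity) (by positivity), Real.log_pow] at h2
    push_cast at h2
    linarith
  have hr4 : (r : ℝ) ≤ 15 * (1 + X) := by linarith
  have hL5 : (L : ℝ) ≤ 3 / 2 * (1 + X) := by linarith
  have hrpos : 1 ≤ r := by
    rcases Nat.eq_zero_or_pos r with h | h
    · rw [h, pow_zero] at hr1
      have : 128 ≤ a := by
        rw [ha, le_div_iff₀ hδ]
        linarith
      linarith
    · exact h
  have hrpos' : (1 : ℝ) ≤ r := by exact_mod_cast hrpos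
  have hr5 := mul_quarter_pow_le hr1 (by linarith)
  obtain ⟨d, hd1, hd2, hd3⟩ := exists_pow_two_gt (r * (4 * 2 ^ L)) (Nat.one_le_iff_ne_zero.2 (by positivity))
  obtain ⟨d', hd1', hd2', hd3'⟩ := exists_pow_two_gt (r * (8 * k)) (Nat.one_le_iff_ne_zero.2 (by positivity))
  push_cast at hd2 hd3 hd2' hd3'
  have hra : (r : ℝ) * (1 / 4) ^ r * (128 * k ^ 2 * 2 ^ L) ≤ δ := by
    have h1 : (r : ℝ) * (1 / 4) ^ r * a ≤ 1 := by
      rwa [le_div_iff₀ (by linarith)] at hr5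
    rw [ha, mul_div_assoc', div_le_one hδ] at h1
    exact h1
  obtain ⟨P, hP1, hP2, hP3⟩ := exists_searchAlgorithm hn hm hk2 hd1 hd1' (by
    rw [le_div_iff₀ (by positivity)]
    calc (2 : ℝ) ^ d * (1 / 4) ^ r * (16 * k ^ 2)
        ≤ (2 * (r * (4 * 2 ^ L))) * (1 / 4) ^ r * (16 * k ^ 2) := by gcongr
      _ = (r : ℝ) * (1 / 4) ^ r * (128 * k ^ 2 * 2 ^ L) := by ring
      _ ≤ 1 := hra.trans hδ1.le) g
  refine ⟨P, ?_, ?_, fun A S hS => ?_⟩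
  · rw [hP1]
    push_cast
    have hdp : (1 : ℝ) ≤ 2 ^ d := one_le_pow₀ one_le_two
    have hdp' : (1 : ℝ) ≤ 2 ^ d' := one_le_pow₀ one_le_two
    have e1 : (2 : ℝ) ^ d' * (2 * (2 ^ d * 2 + 1)) + (2 ^ d * 2 + 1) ≤ 9 * (2 ^ d * 2 ^ d') := by
      have h1 := le_mul_of_one_le_left (zero_le_one.trans hdp') hdp
      have h2 := le_mul_of_one_le_right (zero_le_one.trans hdp) hdp'
      linarith
    -- The three logarithmic factors come from the number of rounds L and from the factor r in the
    -- size of each of the two phase registers.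
    calc (L : ℝ) * ((2 : ℝ) ^ d' * (2 * (2 ^ d * 2 + 1)) + (2 ^ d * 2 + 1))
        ≤ (3 / 2 * (1 + X)) * (9 * (2 ^ d * 2 ^ d')) := by gcongr
      _ ≤ (3 / 2 * (1 + X)) * (9 * ((2 * (r * (4 * 2 ^ L))) * (2 * (r * (8 * k))))) := by gcongr
      _ ≤ (3 / 2 * (1 + X)) * (9 * ((2 * ((15 * (1 + X)) * (4 * (2 * N)))) *
          (2 * ((15 * (1 + X)) * (8 * (3 * √K)))))) := by gcongr
      _ = 2332800 * (1 + X) ^ 3 * (N * √K) := by ring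
      _ ≤ _ := by gcongr; norm_num
  · rw [hP2]
    push_cast
    have hlr : Real.log r ≤ r := (Real.log_le_sub_one_of_pos (by linarith)).trans (by linarith)
    have e1 : Real.log (r * (4 * 2 ^ L)) ≤ 15 * (1 + X) + 2 + 3 / 2 * (1 + X) := by
      rw [Real.log_mul (by positivity) (by positivity), Real.log_mul (by norm_num) (by positivity),
        show (4 : ℝ) = 2 ^ 2 by norm_num, Real.log_pow, Real.log_pow]
      push_cast
      have : (L : ℝ) * Real.log 2 ≤ L :=
        mul_le_of_le_one_right (Nat.cast_nonneg _) (by linarith)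
      linarith
    have hlk : Real.log k ≤ 3 + X := by
      have h1 : (k : ℝ) ≤ 2 ^ 4 * K := by linarith
      have h2 := Real.log_le_log (by linarith) h1
      rw [Real.log_mul (by positivity) (by positivity), Real.log_pow] at h2
      push_cast at h2
      linarith
    have e2 : Real.log (r * (8 * k)) ≤ 15 * (1 + X) + 3 + (3 + X) := by
      rw [Real.log_mul (by positivity) (by positivity), Real.log_mul (by norm_num) (by positivity),
        show (8 : ℝ) = 2 ^ 3 by norm_num, Real.log_pow]
      push_cast
      linarith
    have hcn := clog_two_le hn
    have hcm := clog_two_le hm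
    have hln : 0 ≤ Real.log n := Real.log_natCast_nonneg n
    have hlm : 0 ≤ Real.log m := Real.log_natCast_nonneg m
    linarith
  · refine le_trans ?_ (hP3 A S fun x hx h1 h2 => hS x hx ?_ ?_)
    · have : (L : ℝ) * (2 ^ d' * (1 / 4) ^ r) ≤ δ := by
        calc (L : ℝ) * (2 ^ d' * (1 / 4) ^ r)
            ≤ 2 ^ L * ((2 * (r * (8 * k))) * (1 / 4) ^ r) := by gcongr
          _ = (r : ℝ) * (1 / 4) ^ r * (16 * k * 2 ^ L) := by ring
          _ ≤ (r : ℝ) * (1 / 4) ^ r * (128 * k ^ 2 * 2 ^ L) := by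
              gcongr ?_ * (?_ * _)
              linarith
          _ ≤ δ := hra
      linarith
    · have : (1 / 2 : ℝ) ^ L ≤ 1 / N := by
        rw [div_pow, one_pow]
        exact one_div_le_one_div_of_le hN0 hL1
      linarith
    · refine h2.imp (fun h => h.trans_le ?_) fun h => h.trans ?_
      · rw [div_le_div_iff₀ (by positivity) hK0]
        linarith
      · have : (1 / 2 : ℝ) ^ L ≤ 1 / N := by
          rw [div_pow, one_pow]
          exact one_div_le_one_div_of_le hN0 hL1
        have e : 2 / N = 2 * (1 / N) := by ring
        linarith

/-- The algorithm that returns a constant. -/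
def constantAlgorithm (n m : ℕ) (c : ℝ) : QueryAlgorithm n m := ⟨0, [], fun _ => c⟩

theorem constantAlgorithm_prob (c : ℝ) (A : Fin n → Fin m) {S : Set ℝ} (h : c ∈ S) :
    (constantAlgorithm n m c).prob A S = 1 := by
  simp only [QueryAlgorithm.prob, QueryAlgorithm.finalState, constantAlgorithm, h, if_true,
    List.foldl_nil]
  have : ∀ x : Bits 0, (fun _ => false) = x := fun x => Subsingleton.elim _ _
  refine (Fintype.sum_unique (ι := Bits 0) _).trans ?_
  have h1 : (single (fun _ => false) (fun _ => false) 1 : Matrix (Bits 0) (Bits 0) ℂ)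
      default default = 1 := by
    rw [single_apply, if_pos ⟨this _, this _⟩]
  exact congrArg Complex.re h1

end Parameters

/-! ### The additive and the relative estimator. -/

theorem exists_additive_estimator {n m : ℕ} {ε δ : ℝ} (hn : 1 ≤ n) (hm : 1 ≤ m) (hε : 0 < ε)
    (hδ : 0 < δ) (hδ1 : δ < 1) (hεn : ε < n) :
    ∃ P : QueryAlgorithm n m,
      (∀ A : Fin n → Fin m, 1 - δ ≤ P.prob A {F : ℝ | |F - (modalFrequency A : ℝ)| ≤ ε}) ∧
      (P.queries : ℝ) ≤ 10 ^ 10 * (((n : ℝ) / ε) ^ (3 / 2 : ℝ) * Real.log (n / ε)) *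
        Real.log (n / (δ * ε)) ^ 3 ∧
      (P.qubits : ℝ) ≤
        10 ^ 10 * ((Real.log m + Real.log (n / ε)) * Real.log (n / (δ * ε)) + Real.log n) := by
  have hn0 : (0 : ℝ) < n := by exact_mod_cast hn
  have hδε : δ * ε ≤ ε := mul_le_of_le_one_left hε.le hδ1.le
  have hlm : 0 ≤ Real.log m := Real.log_natCast_nonneg m
  have hln : 0 ≤ Real.log n := Real.log_natCast_nonneg n
  have hl1 : 0 ≤ Real.log (n / ε) := Real.log_nonneg ((one_le_div hε).2 hεn.le)
  have hl2 : Real.log (n / ε) ≤ Real.log (n / (δ * ε)) :=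
    Real.log_le_log (by positivity) (div_le_div_of_nonneg_left hn0.le (by positivity) hδε)
  -- Here log(n/ε) may be arbitrarily close to 0, so the bound leaves no room for queries; the
  -- constant n/2 is accurate enough. Otherwise log(n/ε) ≥ log 2 absorbs additive constants.
  by_cases hbig : (n : ℝ) ≤ 2 * ε
  · refine ⟨constantAlgorithm n m (n / 2), fun A => ?_, ?_, ?_⟩
    · rw [constantAlgorithm_prob]
      · linarith
      · have h1 : (modalFrequency A : ℝ) ≤ n := by exact_mod_cast modalFrequency_le A
        have h2 : (0 : ℝ) ≤ modalFrequency A := Nat.cast_nonneg _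
        rw [Set.mem_ofPred_eq, abs_le]
        constructor <;> linarith
    · have : (constantAlgorithm n m (n / 2)).queries = 0 := rfl
      rw [this, Nat.cast_zero]
      have := hl1.trans hl2
      positivity
    · have : (constantAlgorithm n m (n / 2)).qubits = 0 := rfl
      rw [this, Nat.cast_zero]
      have := hl1.trans hl2
      positivity
  · set N := (n : ℝ) / ε with hN
    have hN2 : 2 ≤ N := (le_div_iff₀ hε).2 (by linarith)
    have hnN : n = N * ε := by rw [hN]; field_simp
    have hlog2 := Real.log_two_gt_d9
    have hlogN : Real.log 2 ≤ Real.log N := Real.log_le_log zero_lt_two hN2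
    -- The output n·x exceeds the modal frequency by at most ε/2. It falls short by at most ε, also
    -- when Φ < 1/K, since then the modal frequency itself is below ε.
    obtain ⟨P, hP1, hP2, hP3⟩ := exists_estimator hn hm (K := N) (N := 2 * N) (by linarith)
      (by linarith) hδ hδ1 fun x => n * x
    set Y := Real.log (n / (δ * ε)) with hY
    have hY' : Y = Real.log (N / δ) := by rw [hY, hN, div_div, mul_comm]
    have hX : 1 + Real.log (N * (2 * N) / δ) ≤ 5 * Y := by
      have h1 : N * (2 * N) / δ ≤ 2 * (N / δ) ^ 2 := by
        rw [show 2 * (N / δ) ^ 2 = 2 * N ^ 2 / δ ^ 2 by ring, div_le_div_iff₀ hδ (by positivity)]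
        have : δ ^ 2 ≤ δ := by nlinarith
        linarith [mul_le_mul_of_nonneg_left this (show 0 ≤ 2 * N ^ 2 by positivity)]
      have h2 := Real.log_le_log (by positivity) h1
      rw [Real.log_mul (by norm_num) (by positivity), Real.log_pow, ← hY'] at h2
      push_cast at h2
      have := Real.log_two_lt_d9
      linarith
    have hX0 : 0 ≤ 1 + Real.log (N * (2 * N) / δ) := by
      have : 0 ≤ Real.log (N * (2 * N) / δ) := Real.log_nonneg (by
        rw [le_div_iff₀ hδ]
        have := mul_le_mul hN2 hN2 zero_le_two (by linarith)
        linarith)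
      linarith
    refine ⟨P, fun A => hP3 A _ fun x hx h1 h2 => ?_, hP1.trans ?_, hP2.trans ?_⟩
    · rw [Set.mem_ofPred_eq, abs_le]
      rw [le_div_iff₀ hn0] at h1
      have e1 : (n : ℝ) * (1 / (2 * N)) = ε / 2 := by rw [hnN]; field_simp
      have e2 : (n : ℝ) * (2 / (2 * N)) = ε := by rw [hnN]; field_simp
      have e3 : (n : ℝ) * (1 / N) = ε := by rw [hnN]; field_simp
      have hnx : 0 ≤ (n : ℝ) * x := by positivity
      constructor
      · rcases h2 with h2 | h2
        · rw [div_lt_iff₀ hn0] at h2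
          linarith
        · rw [div_le_iff₀ hn0] at h2
          linarith
      · linarith
    · have hpow : N ^ (3 / 2 : ℝ) = N * √N := by
        rw [show (3 / 2 : ℝ) = 1 + 1 / 2 by norm_num, Real.rpow_add (by linarith), Real.rpow_one,
          Real.sqrt_eq_rpow]
      rw [hpow]
      have hY0 : 0 ≤ Y := hl1.trans hl2
      calc 3000000 * (1 + Real.log (N * (2 * N) / δ)) ^ 3 * (2 * N * √N)
          ≤ 3000000 * (5 * Y) ^ 3 * (2 * N * √N) := by gcongr
        _ = 750000000 * (N * √N * 1) * Y ^ 3 := by ring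
        _ ≤ 750000000 * (N * √N * (3 / 2 * Real.log N)) * Y ^ 3 := by gcongr; linarith
        _ = 1125000000 * (N * √N * Real.log N) * Y ^ 3 := by ring
        _ ≤ 10 ^ 10 * (N * √N * Real.log N) * Y ^ 3 := by gcongr; norm_num
    -- Both logarithms are at least 2/3, so the products in the bound dominate their factors and the
    -- constants.
    · have h0 : 2 / 3 ≤ Real.log N := by linarith
      have hY1 : 2 / 3 ≤ Y := h0.trans hl2
      have hY0 : 0 ≤ Y := hl1.trans hl2
      have h1 := mul_le_mul_of_nonneg_right h0 hY0
      have h2 := mul_le_mul_of_nonneg_left hY1 hlm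
      have h3 := mul_nonneg hl1 hY0
      have h4 := mul_nonneg hlm hY0
      linarith

theorem exists_relative_estimator {n m : ℕ} {ε δ : ℝ} (hn : 1 ≤ n) (hm : 1 ≤ m) (hε : 0 < ε)
    (hδ : 0 < δ) (hδ1 : δ < 1) (hε1 : ε < 1) :
    ∃ P : QueryAlgorithm n m,
      (∀ A : Fin n → Fin m,
        1 - δ ≤ P.prob A {F : ℝ | |F - (modalFrequency A : ℝ)| ≤ ε * modalFrequency A ∧
          (1 - ε) * F ≤ modalFrequency A ∧ (modalFrequency A : ℝ) ≤ F}) ∧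
      (P.queries : ℝ) ≤ 10 ^ 10 * ((m : ℝ) ^ (3 / 2 : ℝ) / ε) * Real.log (m / (δ * ε)) ^ 3 ∧
      (P.qubits : ℝ) ≤
        10 ^ 10 * ((Real.log (m / ε) + Real.log n) * Real.log (n / (δ * ε))) := by
  have hn0 : (0 : ℝ) < n := by exact_mod_cast hn
  have hm0 : (0 : ℝ) < m := by exact_mod_cast hm
  have hn1 : (1 : ℝ) ≤ n := by exact_mod_cast hn
  have hm1 : (1 : ℝ) ≤ m := by exact_mod_cast hm
  have hδε : 0 < δ * ε := by positivity
  have hδε1 : δ * ε ≤ 1 := mul_le_one₀ hδ1.le hε.le hε1.le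
  have hln : 0 ≤ Real.log n := Real.log_natCast_nonneg n
  have hlm : 0 ≤ Real.log m := Real.log_natCast_nonneg m
  have hle : 0 ≤ Real.log (1 / ε) := Real.log_nonneg ((one_le_div hε).2 hε1.le)
  have hld : 0 ≤ Real.log (1 / δ) := Real.log_nonneg ((one_le_div hδ).2 hδ1.le)
  have e1 : Real.log (m / ε) = Real.log m + Real.log (1 / ε) := by
    rw [← Real.log_mul (by positivity) (by positivity), mul_one_div]
  have e2 : Real.log (n / (δ * ε)) = Real.log n + Real.log (1 / δ) + Real.log (1 / ε) := by
    rw [← Real.log_mul (by positivity) (by positivity),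
      ← Real.log_mul (by positivity) (by positivity)]
    congr 1
    field_simp
  have e3 : Real.log (m / (δ * ε)) = Real.log m + Real.log (1 / δ) + Real.log (1 / ε) := by
    rw [← Real.log_mul (by positivity) (by positivity),
      ← Real.log_mul (by positivity) (by positivity)]
    congr 1
    field_simp
  -- In these cases the logarithms in the bounds can be too small to absorb constants, but the modal
  -- frequency is always n.
  by_cases htriv : n = 1 ∨ m = 1
  · have hconst : ∀ A : Fin n → Fin m, modalFrequency A = n := by
      intro A
      have h1 := modalFrequency_le A
      have h2 := le_mul_modalFrequency A
      rcases htriv with h | h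
      · have : modalFrequency A ≠ 0 := by
          intro h0
          rw [h0] at h2
          omega
        omega
      · subst h
        omega
    refine ⟨constantAlgorithm n m n, fun A => ?_, ?_, ?_⟩
    · rw [constantAlgorithm_prob]
      · linarith
      · rw [Set.mem_ofPred_eq, hconst A, sub_self, abs_zero]
        exact ⟨by positivity, mul_le_of_le_one_left hn0.le (by linarith), le_rfl⟩
    · have : (constantAlgorithm n m n).queries = 0 := rfl
      rw [this, Nat.cast_zero, e3]
      positivity
    · have : (constantAlgorithm n m n).qubits = 0 := rfl
      rw [this, Nat.cast_zero, e1, e2]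
      positivity
  · push Not at htriv
    have hn2 : (2 : ℝ) ≤ n := by exact_mod_cast (by omega : 2 ≤ n)
    have hm2 : (2 : ℝ) ≤ m := by exact_mod_cast (by omega : 2 ≤ m)
    have hlog2 := Real.log_two_gt_d9
    have hln2 : Real.log 2 ≤ Real.log n := Real.log_le_log zero_lt_two hn2
    have hlm2 : Real.log 2 ≤ Real.log m := Real.log_le_log zero_lt_two hm2
    have hmε : m ≤ m / ε := by
      rw [le_div_iff₀ hε]
      exact mul_le_of_le_one_right hm0.le hε1.le
    -- The estimate is shifted up by 2/N to be an upper bound. Its total excess is at most 3n/N =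
    -- εn/m, which is at most ε times the modal frequency. The cutoff 1/K = 1/m is never undercut.
    obtain ⟨P, hP1, hP2, hP3⟩ := exists_estimator hn hm (K := m) (N := 3 * (m / ε)) hm1
      (by linarith) hδ hδ1 fun x => n * (x + 2 / (3 * (m / ε)))
    have hX : Real.log (m * (3 * (m / ε)) / δ)
        = Real.log 3 + 2 * Real.log m + Real.log (1 / ε) + Real.log (1 / δ) := by
      rw [show (m : ℝ) * (3 * (m / ε)) / δ = 3 * m ^ 2 * (1 / ε) * (1 / δ) by field_simp,
        Real.log_mul (by positivity) (by positivity), Real.log_mul (by positivity) (by positivity),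
        Real.log_mul (by positivity) (by positivity), Real.log_pow]
      push_cast
      rfl
    have hlog3 : Real.log 3 ≤ 2 :=
      (Real.log_le_sub_one_of_pos (by norm_num)).trans (by norm_num)
    have hlog3' : 0 ≤ Real.log 3 := Real.log_nonneg (by norm_num)
    refine ⟨P, fun A => hP3 A _ fun x hx h1 h2 => ?_, hP1.trans ?_, hP2.trans ?_⟩
    · have hF : (n : ℝ) ≤ m * modalFrequency A := by exact_mod_cast le_mul_modalFrequency A
      have hnot : ¬ (modalFrequency A : ℝ) / n < 1 / m := by
        rw [not_lt, div_le_div_iff₀ hm0 hn0]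
        linarith
      have h3 := h2.resolve_left hnot
      rw [div_le_iff₀ hn0] at h3
      rw [le_div_iff₀ hn0] at h1
      have e5 : (n : ℝ) * (1 / (3 * (m / ε))) * 3 = ε * (n / m) := by field_simp
      have e6 : (n : ℝ) * (2 / (3 * (m / ε))) = 2 * (n * (1 / (3 * (m / ε)))) := by ring
      have hnm : (n : ℝ) / m ≤ modalFrequency A := by
        rw [div_le_iff₀ hm0]
        linarith
      have h4 : ε * (n / m) ≤ ε * modalFrequency A := mul_le_mul_of_nonneg_left hnm hε.le
      have hlow : (modalFrequency A : ℝ) ≤ n * (x + 2 / (3 * (m / ε))) := by linarith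
      have hup : (n : ℝ) * (x + 2 / (3 * (m / ε))) ≤ (1 + ε) * modalFrequency A := by
        rw [mul_add, e6]
        linarith
      refine ⟨?_, ?_, hlow⟩
      · rw [abs_le]
        constructor <;> linarith
      · have h0 : (0 : ℝ) ≤ modalFrequency A := Nat.cast_nonneg _
        calc (1 - ε) * (n * (x + 2 / (3 * (m / ε))))
            ≤ (1 - ε) * ((1 + ε) * modalFrequency A) :=
              mul_le_mul_of_nonneg_left hup (by linarith)
          _ ≤ modalFrequency A := by linarith [mul_nonneg (sq_nonneg ε) h0]
    · have hpow : (m : ℝ) ^ (3 / 2 : ℝ) = m * √m := by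
        rw [show (3 / 2 : ℝ) = 1 + 1 / 2 by norm_num, Real.rpow_add hm0, Real.rpow_one,
          Real.sqrt_eq_rpow]
      rw [hpow, hX, e3]
      set Y := Real.log m + Real.log (1 / δ) + Real.log (1 / ε) with hY
      have hY0 : 0 ≤ Y := by positivity
      have h1 : 1 + (Real.log 3 + 2 * Real.log m + Real.log (1 / ε) + Real.log (1 / δ)) ≤ 8 * Y := by
        linarith
      calc 3000000 * (1 + (Real.log 3 + 2 * Real.log m + Real.log (1 / ε) + Real.log (1 / δ))) ^ 3 *
            (3 * (m / ε) * √m)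
          ≤ 3000000 * (8 * Y) ^ 3 * (3 * (m / ε) * √m) := by gcongr
        _ = 4608000000 * (m * √m / ε) * Y ^ 3 := by ring
        _ ≤ _ := by gcongr; norm_num
    · rw [hX, e1, e2]
      set a := Real.log m + Real.log (1 / ε) + Real.log n with ha
      set b := Real.log n + Real.log (1 / δ) + Real.log (1 / ε) with hb
      have ha1 : 1 ≤ a := by linarith
      have hb1 : 1 / 2 ≤ b := by linarith
      have h1 : a ≤ 2 * (a * b) := by
        linarith [mul_le_mul_of_nonneg_left hb1 (zero_le_one.trans ha1)]
      have h2 : b ≤ a * b := le_mul_of_one_le_left (by linarith) ha1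
      linarith

theorem mainTheorem6 :
    ∃ (C : ℝ) (k : ℕ), 0 < C ∧
      ∀ (n m : ℕ) (ε δ : ℝ), 1 ≤ n → 1 ≤ m → 0 < ε → 0 < δ → δ < 1 →
        (ε < n →
          ∃ P : QueryAlgorithm n m,
            (∀ A : Fin n → Fin m,
              1 - δ ≤ P.prob A {F : ℝ | |F - (modalFrequency A : ℝ)| ≤ ε}) ∧
            (P.queries : ℝ) ≤
              C * (((n : ℝ) / ε) ^ (3 / 2 : ℝ) * Real.log (n / ε)) *
                Real.log (n / (δ * ε)) ^ k ∧
            (P.qubits : ℝ) ≤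
              C * ((Real.log m + Real.log (n / ε)) * Real.log (n / (δ * ε)) + Real.log n)) ∧
        (ε < 1 →
          ∃ P : QueryAlgorithm n m,
            (∀ A : Fin n → Fin m,
              1 - δ ≤ P.prob A {F : ℝ | |F - (modalFrequency A : ℝ)| ≤ ε * modalFrequency A ∧
                (1 - ε) * F ≤ modalFrequency A ∧ (modalFrequency A : ℝ) ≤ F}) ∧
            (P.queries : ℝ) ≤
              C * ((m : ℝ) ^ (3 / 2 : ℝ) / ε) * Real.log (m / (δ * ε)) ^ k ∧
            (P.qubits : ℝ) ≤
              C * ((Real.log (m / ε) + Real.log n) * Real.log (n / (δ * ε)))) :=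
  ⟨10 ^ 10, 3, by norm_num, fun _ _ _ _ hn hm hε hδ hδ1 =>
    ⟨exists_additive_estimator hn hm hε hδ hδ1, exists_relative_estimator hn hm hε hδ hδ1⟩⟩
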